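/- Consider a reconfigurable intelligent surface (RIS) made of $N$ lossless isotropic radiators forming a uniform linear array with element spacing $d>0$, at wavelength $\lambda>0$. Let $k=2\pi/\lambda$ and $R>0$, and let $Z_R\in\mathbb C^{N\times N}$ be the array impedance matrix, $[Z_R]_{ii}=R$ and $[Z_R]_{il}=-\frac{R}{\mathrm j k d|i-l|}e^{-\mathrm j k d|i-l|}$ for $i\ne l$. For an angle $\alpha$ let $a(\alpha)\in\mathbb C^N$ have the entries $a_n(\alpha)=e^{-\mathrm j(n-1)kd\cos\alpha}$, $n=1,\dots,N$. The direct link from the base station (BS) to the user is blocked; the single-antenna BS is placed in the end-fire direction $\alpha_{\mathrm{Tx}}=0$ of the RIS, and the single-antenna user is at an arbitrary angle $\alpha_{\mathrm{Rx}}$. The channels are $z_{RS}=\sqrt{\gamma_{RS}}\,R\,a(0)$ and $z_{DR}=\sqrt{\gamma_{DR}}\,R\,a(\alpha_{\mathrm{Rx}})$ with $\gamma_{RS},\gamma_{DR}>0$. The RIS is a lossless, reciprocal, fully-connected BD-RIS: its network $Z_N=\mathrm jX$ may be any with $X\in\mathbb R^{N\times N}$ symmetric, and the resulting channel is $z(X)=-z_{DR}^{\mathrm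 T}(Z_R+\mathrm jX)^{-1}z_{RS}$. The array gain is $$A_{\mathrm{BD}}(d)=\frac{\sup_{X}|z(X)|^2\ \text{for } N \text{ elements}}{\sup_{X}|z(X)|^2\ \text{for one element}} .$$ Then for every $d>0$ the matrices $Z_R+\mathrm jX$ are invertible and $\sup_X|z(X)|^2$ is finite, and for every user angle $\alpha_{\mathrm{Rx}}$ the limit of $A_{\mathrm{BD}}(d)$ as $d\to0^+$ exists and satisfies $$\lim_{d\to0^+}A_{\mathrm{BD}}(d)\ \ge\ \frac{N^3}{8}.$$ -/

import Mathlib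

noncomputable section

namespace RIS

/-- The phase advance `k d` between neighbouring elements, where `k = 2π / lam` is the wave number
of the wavelength `lam` and `d` is the element spacing (a length). -/
def phaseStep (lam d : ℝ) : ℝ := 2 * Real.pi / lam * d

/-- The impedance matrix `Z_R` of a uniform linear array of `N` lossless isotropic radiators with
self-resistance `R` and spacing `d`. -/
def arrayImpedance (N : ℕ) (R lam d : ℝ) : Matrix (Fin N) (Fin N) ℂ :=
  Matrix.of fun i j =>
    if i = j then (R : ℂ)
    else
      -((R : ℂ) / (Complex.I * ((phaseStep lam d * |(i : ℝ) - (j : ℝ)| : ℝ) : ℂ))) *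
        Complex.exp (-(Complex.I * ((phaseStep lam d * |(i : ℝ) - (j : ℝ)| : ℝ) : ℂ)))

/-- The line-of-sight steering vector `a(α)` of the array. The indices run through
`0, …, N - 1`. -/
def steering (N : ℕ) (lam d α : ℝ) : Fin N → ℂ := fun n =>
  Complex.exp (-(Complex.I * (((n : ℝ) * phaseStep lam d * Real.cos α : ℝ) : ℂ)))

/-- The line-of-sight channel vector `√γ · a(α) · R` with path loss `√γ`. -/
def losChannel (N : ℕ) (R lam γ d α : ℝ) : Fin N → ℂ :=
  ((Real.sqrt γ * R : ℝ) : ℂ) • steering N lam d α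

/-- The network `Z_N = j X` in series with the array, that is, `Z_R + j X`. -/
def loadedImpedance (N : ℕ) (R lam d : ℝ) (X : Matrix (Fin N) (Fin N) ℝ) :
    Matrix (Fin N) (Fin N) ℂ :=
  arrayImpedance N R lam d + Complex.I • X.map Complex.ofReal

/-- The end-to-end channel `z = z_DS - z_DRᵀ (Z_R + Z_N)⁻¹ z_RS` with a single transmit and a single
receive antenna, for a RIS terminated by the network `Z_N = j X`. -/
def channel (N : ℕ) (R lam d : ℝ) (zDS : ℂ) (zDR zRS : Fin N → ℂ)
    (X : Matrix (Fin N) (Fin N) ℝ) : ℂ :=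
  zDS - dotProduct zDR ((loadedImpedance N R lam d X)⁻¹.mulVec zRS)

/-- The channel gains `|z|²` that a fully-connected lossless reciprocal BD-RIS can realize: the
network `Z_N = j X` runs through all real symmetric `X`. The direct link is blocked, the base
station is seen at the angle `αTx` and the user at the angle `αRx`. -/
def channelGains (N : ℕ) (R lam γDR γRS αTx αRx d : ℝ) : Set ℝ :=
  {g | ∃ X : Matrix (Fin N) (Fin N) ℝ, X.IsSymm ∧
    g = ‖channel N R lam d 0 (losChannel N R lam γDR d αRx) (losChannel N R lam γRS d αTx) X‖ ^ 2}

/-- The channel gain of the fully-connected BD-RIS, optimized over its network. -/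
def channelGain (N : ℕ) (R lam γDR γRS αTx αRx d : ℝ) : ℝ :=
  sSup (channelGains N R lam γDR γRS αTx αRx d)

/-- The array gain `A_BD` of the fully-connected BD-RIS: the channel gain of `N` elements divided by
the channel gain of one element. -/
def arrayGain (N : ℕ) (R lam γDR γRS αTx αRx d : ℝ) : ℝ :=
  channelGain N R lam γDR γRS αTx αRx d / channelGain 1 R lam γDR γRS αTx αRx d

end RIS

end

/-!
Write `Z_R = R C + jB` with real symmetric `C`, `B`. Since `X` is arbitrary, so is `Y = B + X`, and
`z(X)` runs, up to a constant factor, through `pᵀ (R C + jY)⁻¹ q` for real symmetric `Y`, with the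
steering vectors `p = a(α_Rx)` and `q = a(0)`. The matrix `C` has the entries
`sinc (kd (i - l))`: it is the Gram matrix of the plane waves on the interval `[-1, 1]` of direction
cosines, hence positive definite, and `R C + jY` is invertible.

*The optimal network.* After a congruence one may take `1 + jY` in place of `R C + jY`. The matrix
`2 (1 + jY)⁻¹ - 1 = (1 - jY)(1 + jY)⁻¹` is unitary, so `|pᵀ (1 + jY)⁻¹ q|` is at most
`(|pᵀ q| + ‖p‖ ‖q‖) / 2`. The bound is the supremum (`exists_tendsto_norm_dotProduct_inv`): the
unitary matrix has to send `q` to a certain multiple of the conjugate of `p`, which is a linear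
equation `Y s = t` with `⟨s, t⟩ = 0`, and real symmetric matrices solve it approximately. So the
array gain is `((|K(-c, 1)| + √(K(c, c) K(1, 1))) / 2)²` with `c = cos α_Rx` and
`K(x, y) = a(x)ᴴ C⁻¹ a(y)`, where `a(x)` is the plane wave whose direction has the cosine `x`.

*Vanishing spacing.* The kernel `K` depends only on the span of the plane waves in `L²(-1, 1)`.
Another basis of this span, the powers of `(e^{-jkdu} - 1) / (-jkd)`, tends to the monomials. Hence
`K` tends to the Christoffel–Darboux kernel `∑_{n<N} (2n+1) P_n(x) P_n(y)` of the Legendre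
polynomials (`arrayKernel_zero`, `continuousAt_arrayKernel`).

*The bound.* The limit is at least `K(c, c) K(1, 1) / 4`. Here `K(1, 1) = N²`, and it remains to see
that `K(c, c) ≥ N / 2` for every `c` (`half_le_sum_legendre_sq`). With `n = N - 1`, the confluent
Christoffel–Darboux identity gives `K(x, x) = N² P_n(x)² + (1 - x²) P_n'(x)²`. This is at least
`n (n+1) P_n(x)² + (1 - x²) P_n'(x)²`, a function with the derivative `2 x P_n'(x)²`, which is
therefore smallest at `x = 0`. Its value there is at least `N / 2` for `N ≥ 2`, because
`2n P_n(0)² ≥ 1` for even `n ≥ 2`.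
-/

namespace RIS

open Polynomial

/-! ### Legendre polynomials -/

/-- The Legendre polynomials `P_n`, normalized by `P_n(1) = 1` and defined by Bonnet's three-term
recurrence `(n + 2) P_{n+2} = (2n + 3) x P_{n+1} - (n + 1) P_n`. -/
noncomputable def legendre : ℕ → ℝ[X]
  | 0 => 1
  | 1 => X
  | n + 2 => C ((2 * n + 3 : ℝ) / (n + 2)) * X * legendre (n + 1)
      - C ((n + 1 : ℝ) / (n + 2)) * legendre n

theorem legendre_recurrence (n : ℕ) (x : ℝ) :
    (n + 2) * (legendre (n + 2)).eval x =
      (2 * n + 3) * x * (legendre (n + 1)).eval x - (n + 1) * (legendre n).eval x := by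
  have h : (n + 2 : ℝ) ≠ 0 := by positivity
  simp only [legendre, eval_sub, eval_mul, eval_C, eval_X]
  field_simp

theorem natDegree_legendre_le : ∀ n : ℕ, (legendre n).natDegree ≤ n
  | 0 => by simp [legendre]
  | 1 => by simp [legendre]
  | n + 2 => by
    have h0 := natDegree_legendre_le n
    have h1 := natDegree_legendre_le (n + 1)
    rw [legendre, mul_assoc]
    refine (natDegree_sub_le _ _).trans (max_le ?_ ?_)
    · refine (natDegree_C_mul_le _ _).trans (natDegree_mul_le.trans ?_)
      rw [natDegree_X]
      omega
    · exact (natDegree_C_mul_le _ _).trans (by omega)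

theorem legendre_eval_one : ∀ n : ℕ, (legendre n).eval 1 = 1
  | 0 => by simp [legendre]
  | 1 => by simp [legendre]
  | n + 2 => by
    have h := legendre_recurrence n 1
    rw [legendre_eval_one n, legendre_eval_one (n + 1)] at h
    have h2 : (n + 2 : ℝ) ≠ 0 := by positivity
    exact mul_left_cancel₀ h2 (by linarith)

/-- The two first-order relations between neighbouring Legendre polynomials. Each of them at
`n + 1` needs both of them at `n`, so they are proved together. -/
theorem legendre_derivative_relations (n : ℕ) (x : ℝ) :
    (derivative (legendre (n + 1))).eval x =
        x * (derivative (legendre n)).eval x + (n + 1) * (legendre n).eval x ∧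
      x * (derivative (legendre (n + 1))).eval x - (derivative (legendre n)).eval x =
        (n + 1) * (legendre (n + 1)).eval x := by
  induction n with
  | zero => simp [legendre]
  | succ n ih =>
    obtain ⟨hA, hB⟩ := ih
    have h2 : (n + 2 : ℝ) ≠ 0 := by positivity
    have hrec := legendre_recurrence n x
    have hd : (n + 2) * (derivative (legendre (n + 2))).eval x =
        (2 * n + 3) * (legendre (n + 1)).eval x
          + (2 * n + 3) * x * (derivative (legendre (n + 1))).eval x
          - (n + 1) * (derivative (legendre n)).eval x := by
      simp only [legendre, derivative_sub, derivative_mul, derivative_C, derivative_X, eval_sub,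
        eval_add, eval_mul, eval_C, eval_X, eval_zero, eval_one]
      field_simp
      ring
    push_cast
    have hA' : (derivative (legendre (n + 2))).eval x =
        x * (derivative (legendre (n + 1))).eval x + (n + 2) * (legendre (n + 1)).eval x := by
      apply mul_left_cancel₀ h2
      linear_combination hd + (n + 1) * hB
    refine ⟨by linear_combination hA', ?_⟩
    linear_combination x * hA' - hA + x * hB - hrec

theorem one_sub_sq_mul_derivative_legendre_succ (n : ℕ) (x : ℝ) :
    (1 - x ^ 2) * (derivative (legendre (n + 1))).eval x =
      (n + 1) * ((legendre n).eval x - x * (legendre (n + 1)).eval x) := by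
  obtain ⟨hA, hB⟩ := legendre_derivative_relations n x
  linear_combination hA - x * hB

theorem one_sub_sq_mul_derivative_legendre (n : ℕ) (x : ℝ) :
    (1 - x ^ 2) * (derivative (legendre n)).eval x =
      (n + 1) * (x * (legendre n).eval x - (legendre (n + 1)).eval x) := by
  obtain ⟨hA, hB⟩ := legendre_derivative_relations n x
  linear_combination x * hA - hB

/-- Legendre's differential equation, in self-adjoint form. -/
theorem legendre_ode (n : ℕ) :
    derivative ((1 - X ^ 2) * derivative (legendre n)) = -C (n * (n + 1) : ℝ) * legendre n := by
  cases n with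
  | zero => simp [legendre]
  | succ n =>
    have h : (1 - X ^ 2) * derivative (legendre (n + 1)) =
        C (n + 1 : ℝ) * (legendre n - X * legendre (n + 1)) := by
      refine Polynomial.funext fun x => ?_
      simpa using one_sub_sq_mul_derivative_legendre_succ n x
    rw [h]
    refine Polynomial.funext fun x => ?_
    have hB := (legendre_derivative_relations n x).2
    simp only [derivative_mul, derivative_C, derivative_sub, derivative_X, eval_add, eval_mul,
      eval_sub, eval_C, eval_zero, eval_X, eval_one, eval_neg]
    push_cast
    linear_combination -(n + 1 : ℝ) * hB

theorem integral_eval_derivative (p : ℝ[X]) (a b : ℝ) :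
    ∫ x in a..b, (derivative p).eval x = p.eval b - p.eval a :=
  intervalIntegral.integral_eq_sub_of_hasDerivAt (fun x _ => p.hasDerivAt x)
    (derivative p).continuous.continuousOn.intervalIntegrable

/-- Legendre polynomials of different degrees are orthogonal: their Wronskian, multiplied by
`1 - x²`, vanishes at both ends of the interval. -/
theorem integral_legendre_mul_of_ne {n m : ℕ} (h : n ≠ m) :
    ∫ x in (-1 : ℝ)..1, (legendre n).eval x * (legendre m).eval x = 0 := by
  have key := integral_eval_derivative
    (legendre n * ((1 - X ^ 2) * derivative (legendre m))
      - legendre m * ((1 - X ^ 2) * derivative (legendre n))) (-1) 1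
  have hder : derivative (legendre n * ((1 - X ^ 2) * derivative (legendre m))
      - legendre m * ((1 - X ^ 2) * derivative (legendre n))) =
      C ((n * (n + 1) : ℝ) - m * (m + 1)) * (legendre n * legendre m) := by
    rw [derivative_sub, derivative_mul (f := legendre n), derivative_mul (f := legendre m),
      legendre_ode, legendre_ode, C_sub]
    ring
  rw [hder] at key
  simp only [eval_mul, eval_C, eval_sub, eval_one, eval_pow, eval_X,
    intervalIntegral.integral_const_mul] at key
  norm_num at key
  refine key.resolve_left fun h0 => h ?_
  have hfac : ((n : ℝ) - m) * (n + m + 1) = 0 := by linear_combination h0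
  have hpos : (n + m + 1 : ℝ) ≠ 0 := by positivity
  exact_mod_cast sub_eq_zero.1 ((mul_eq_zero.1 hfac).resolve_right hpos)

theorem intervalIntegrable_eval (p : ℝ[X]) (a b : ℝ) :
    IntervalIntegrable (fun x => p.eval x) MeasureTheory.volume a b :=
  p.continuous.continuousOn.intervalIntegrable

/-- Both sides are evaluations of `∫ x P_n P_{n+1}`, by the recurrence for `P_{n+1}` and for
`P_{n+2}`. -/
theorem integral_legendre_sq_succ (n : ℕ) :
    (2 * n + 3) * ∫ x in (-1 : ℝ)..1, (legendre (n + 1)).eval x * (legendre (n + 1)).eval x =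
      (2 * n + 1) * ∫ x in (-1 : ℝ)..1, (legendre n).eval x * (legendre n).eval x := by
  have hint : ∀ i j : ℕ, IntervalIntegrable
      (fun x : ℝ => (legendre i).eval x * (legendre j).eval x) MeasureTheory.volume (-1) 1 :=
    fun i j => by simpa using intervalIntegrable_eval (legendre i * legendre j) (-1) 1
  have hup : (2 * n + 3) * ∫ x in (-1 : ℝ)..1, x * ((legendre n).eval x * (legendre (n + 1)).eval x)
      = (n + 1) * ∫ x in (-1 : ℝ)..1, (legendre n).eval x * (legendre n).eval x := by
    have h : ∀ x : ℝ, (2 * n + 3 : ℝ) * (x * ((legendre n).eval x * (legendre (n + 1)).eval x)) =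
        (n + 2) * ((legendre n).eval x * (legendre (n + 2)).eval x)
          + (n + 1) * ((legendre n).eval x * (legendre n).eval x) := fun x => by
      linear_combination -(legendre n).eval x * legendre_recurrence n x
    rw [← intervalIntegral.integral_const_mul]
    simp_rw [h]
    rw [intervalIntegral.integral_add ((hint _ _).const_mul _) ((hint _ _).const_mul _),
      intervalIntegral.integral_const_mul, intervalIntegral.integral_const_mul,
      integral_legendre_mul_of_ne (by omega : n ≠ n + 2)]
    ring
  have hdown : (2 * n + 1) *
      ∫ x in (-1 : ℝ)..1, x * ((legendre n).eval x * (legendre (n + 1)).eval x)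
      = (n + 1) * ∫ x in (-1 : ℝ)..1, (legendre (n + 1)).eval x * (legendre (n + 1)).eval x := by
    rw [← intervalIntegral.integral_const_mul]
    cases n with
    | zero => simp [legendre]
    | succ n =>
      have h : ∀ x : ℝ, (2 * (n + 1 : ℕ) + 1 : ℝ) *
          (x * ((legendre (n + 1)).eval x * (legendre (n + 2)).eval x)) =
          (n + 2) * ((legendre (n + 2)).eval x * (legendre (n + 2)).eval x)
            + (n + 1) * ((legendre n).eval x * (legendre (n + 2)).eval x) := fun x => by
        push_cast
        linear_combination -(legendre (n + 2)).eval x * legendre_recurrence n x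
      simp_rw [h]
      rw [intervalIntegral.integral_add ((hint _ _).const_mul _) ((hint _ _).const_mul _),
        intervalIntegral.integral_const_mul, intervalIntegral.integral_const_mul,
        integral_legendre_mul_of_ne (by omega : n ≠ n + 2)]
      push_cast
      ring
  have hn : (n + 1 : ℝ) ≠ 0 := by positivity
  apply mul_left_cancel₀ hn
  linear_combination (2 * n + 1) * hup - (2 * n + 3) * hdown

theorem integral_legendre_sq (n : ℕ) :
    (2 * n + 1) * ∫ x in (-1 : ℝ)..1, (legendre n).eval x * (legendre n).eval x = 2 := by
  induction n with
  | zero => norm_num [legendre]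
  | succ n ih =>
    have h := integral_legendre_sq_succ n
    push_cast
    linear_combination h + ih

/-! ### The Legendre kernel on the diagonal -/

/-- The confluent Christoffel–Darboux identity, written with the last Legendre polynomial and its
derivative. -/
theorem sum_legendre_sq (n : ℕ) (x : ℝ) :
    ∑ i ∈ Finset.range (n + 1), (2 * i + 1 : ℝ) * (legendre i).eval x ^ 2 =
      (n + 1) ^ 2 * (legendre n).eval x ^ 2
        + (1 - x ^ 2) * (derivative (legendre n)).eval x ^ 2 := by
  induction n with
  | zero => simp [legendre]
  | succ n ih =>
    rw [Finset.sum_range_succ, ih]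
    obtain ⟨hA, hB⟩ := legendre_derivative_relations n x
    have h1 := one_sub_sq_mul_derivative_legendre_succ n x
    have h2 := one_sub_sq_mul_derivative_legendre n x
    push_cast
    linear_combination (derivative (legendre n)).eval x * h2
      - (derivative (legendre (n + 1))).eval x * h1
      - (n + 1) * (legendre n).eval x * hA
      + (n + 1) * (legendre (n + 1)).eval x * hB

/-- Sonin's argument: the derivative of `n (n + 1) P_n² + (1 - x²) P_n'²` is `2 x P_n'²`, so this
function is smallest at the origin. -/
theorem sonin_le (n : ℕ) (x : ℝ) :
    n * (n + 1) * (legendre n).eval 0 ^ 2 + (derivative (legendre n)).eval 0 ^ 2 ≤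
      n * (n + 1) * (legendre n).eval x ^ 2
        + (1 - x ^ 2) * (derivative (legendre n)).eval x ^ 2 := by
  set f : ℝ[X] := C (n * (n + 1) : ℝ) * legendre n ^ 2 + (1 - X ^ 2) * derivative (legendre n) ^ 2
    with hf
  have hder : derivative f = 2 * X * derivative (legendre n) ^ 2 := by
    have hode := legendre_ode n
    simp only [derivative_mul, derivative_sub, derivative_one, derivative_X_pow, zero_sub] at hode
    simp only [hf, derivative_add, derivative_mul, derivative_C, derivative_sub, derivative_one,
      derivative_pow, zero_mul, zero_add, zero_sub]
    have hC : (C (2 : ℝ) : ℝ[X]) = 2 := rfl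
    norm_num [hC] at hode ⊢
    linear_combination 2 * derivative (legendre n) * hode
  -- Along the segment from the origin to `x` the derivative is `2 t x² P_n'(t x)² ≥ 0`.
  have hmono : MonotoneOn (fun t : ℝ => f.eval (t * x)) (Set.Ici 0) := by
    have hd : ∀ t : ℝ, HasDerivAt (fun t : ℝ => f.eval (t * x))
        ((derivative f).eval (t * x) * x) t :=
      fun t => by
        have h : HasDerivAt (fun t : ℝ => t * x) x t := by
          simpa using (hasDerivAt_id t).mul_const x
        exact (f.hasDerivAt (t * x)).comp t h
    refine monotoneOn_of_deriv_nonneg (convex_Ici 0)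
      (fun t _ => (hd t).continuousAt.continuousWithinAt)
      (fun t _ => (hd t).differentiableAt.differentiableWithinAt) fun t ht => ?_
    rw [interior_Ici, Set.mem_Ioi] at ht
    rw [(hd t).deriv, hder]
    simp only [eval_mul, eval_pow, eval_X, eval_ofNat]
    have h : 2 * (t * x) * (derivative (legendre n)).eval (t * x) ^ 2 * x =
      2 * t * (x * (derivative (legendre n)).eval (t * x)) ^ 2 := by ring
    rw [h]
    positivity
  have h := hmono (Set.mem_Ici.2 le_rfl) (Set.mem_Ici.2 zero_le_one) zero_le_one
  simpa [hf] using h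

/-- The bound `P_n(0)² ≥ 1 / (2n)` for even `n ≥ 2`, with equality at `n = 2`. -/
theorem one_le_legendre_eval_zero_sq (m : ℕ) :
    1 ≤ 2 * ((2 * m + 2 : ℕ) : ℝ) * (legendre (2 * m + 2)).eval 0 ^ 2 := by
  induction m with
  | zero => norm_num [legendre]
  | succ m ih =>
    have h := legendre_recurrence (2 * m + 2) 0
    rw [show 2 * (m + 1) + 2 = 2 * m + 2 + 2 by ring]
    push_cast at h ih ⊢
    set p := (legendre (2 * m + 2)).eval 0
    set q := (legendre (2 * m + 2 + 2)).eval 0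
    have hm : (0 : ℝ) < 2 * m + 2 + 2 := by positivity
    have hq : q = -(2 * m + 2 + 1) / (2 * m + 2 + 2) * p := by
      field_simp
      linarith
    have hq2 : 2 * (2 * m + 2 + 2) * q ^ 2 =
        2 * (2 * m + 2) * p ^ 2 + 2 / (2 * m + 2 + 2) * p ^ 2 := by
      rw [hq]
      field_simp
      ring
    rw [hq2]
    have : 0 ≤ 2 / (2 * m + 2 + 2) * p ^ 2 := by positivity
    linarith

/-- For even degree the first term is large enough. For odd degree the second one is, since
`P_{n+1}'(0) = (n + 1) P_n(0)`. -/
theorem sonin_zero_ge (n : ℕ) :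
    (n + 2 : ℝ) / 2 ≤ (n + 1) * (n + 2) * (legendre (n + 1)).eval 0 ^ 2
      + (derivative (legendre (n + 1))).eval 0 ^ 2 := by
  have hA := (legendre_derivative_relations n 0).1
  rw [zero_mul, zero_add] at hA
  rw [hA, mul_pow]
  rcases n.even_or_odd' with ⟨m, rfl | rfl⟩
  · have h0 : 0 ≤ ((2 * m : ℕ) + 1 : ℝ) * ((2 * m : ℕ) + 2) *
        (legendre (2 * m + 1)).eval 0 ^ 2 := by
      positivity
    refine le_add_of_nonneg_of_le h0 ?_
    cases m with
    | zero => norm_num [legendre]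
    | succ m =>
      have h := one_le_legendre_eval_zero_sq m
      rw [show 2 * (m + 1) = 2 * m + 2 by ring]
      push_cast at h ⊢
      set s := (legendre (2 * m + 2)).eval 0 ^ 2
      have hs : 1 / (2 * (2 * m + 2)) ≤ s := by
        rw [div_le_iff₀ (by positivity)]
        linarith
      refine le_trans ?_ (mul_le_mul_of_nonneg_left hs (by positivity))
      rw [mul_one_div, div_le_div_iff₀ (by positivity) (by positivity)]
      nlinarith
  · have h := one_le_legendre_eval_zero_sq m
    refine le_add_of_le_of_nonneg ?_ (by positivity)
    rw [show 2 * m + 1 + 1 = 2 * m + 2 by ring]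
    push_cast at h ⊢
    nlinarith [Nat.cast_nonneg (α := ℝ) m]

/-- The diagonal of the Legendre kernel is at least half the number of its terms. -/
theorem half_le_sum_legendre_sq (N : ℕ) (x : ℝ) :
    (N : ℝ) / 2 ≤ ∑ i ∈ Finset.range N, (2 * i + 1 : ℝ) * (legendre i).eval x ^ 2 := by
  rcases N with _ | _ | n
  · simp
  · norm_num [legendre]
  · rw [sum_legendre_sq]
    have h1 := sonin_zero_ge n
    have h2 := sonin_le (n + 1) x
    push_cast at h1 h2 ⊢
    have h3 : 0 ≤ (n + 2) * (legendre (n + 1)).eval x ^ 2 := by positivity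
    nlinarith

end RIS

namespace RIS

open Filter Topology Matrix WithLp

variable {n : Type*}

/-! ### Real symmetric matrices with prescribed values -/

/-- A real symmetric matrix can be prescribed on two orthogonal vectors as soon as the
prescribed values respect the symmetry. -/
theorem exists_isSymm_mulVec_eq [Fintype n] (u₁ u₂ t₁ t₂ : n → ℝ) (h₁ : u₁ ≠ 0)
    (h₂ : u₂ ≠ 0 ∨ t₂ = 0) (horth : u₁ ⬝ᵥ u₂ = 0) (hsymm : u₁ ⬝ᵥ t₂ = u₂ ⬝ᵥ t₁) :
    ∃ Y : Matrix n n ℝ, Y.IsSymm ∧ Y *ᵥ u₁ = t₁ ∧ Y *ᵥ u₂ = t₂ := by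
  have ha : u₁ ⬝ᵥ u₁ ≠ 0 := fun h => h₁ (dotProduct_self_eq_zero.1 h)
  set a := u₁ ⬝ᵥ u₁ with ha_def
  set b := u₂ ⬝ᵥ u₂ with hb_def
  -- For `u₂ = 0` the scalar `b⁻¹` is `0`, and the terms with `u₂` drop out.
  refine ⟨a⁻¹ • (vecMulVec t₁ u₁ + vecMulVec u₁ t₁) - (a⁻¹ ^ 2 * (u₁ ⬝ᵥ t₁)) • vecMulVec u₁ u₁
    + b⁻¹ • (vecMulVec t₂ u₂ + vecMulVec u₂ t₂) - (b⁻¹ ^ 2 * (u₂ ⬝ᵥ t₂)) • vecMulVec u₂ u₂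
    - (a⁻¹ * b⁻¹ * (u₂ ⬝ᵥ t₁)) • (vecMulVec u₁ u₂ + vecMulVec u₂ u₁), ?_, ?_, ?_⟩
  · ext i j
    simp only [transpose_apply, Matrix.sub_apply, Matrix.add_apply, Matrix.smul_apply,
      vecMulVec_apply, smul_eq_mul]
    ring
  · ext i
    simp only [sub_mulVec, add_mulVec, smul_mulVec, vecMulVec_mulVec, Pi.sub_apply, Pi.add_apply,
      Pi.smul_apply, smul_eq_mul, op_smul_eq_smul]
    rw [dotProduct_comm u₂ u₁, horth, dotProduct_comm t₁ u₁, dotProduct_comm t₂ u₁, hsymm, ← ha_def]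
    field_simp
    ring
  · rcases eq_or_ne u₂ 0 with rfl | hu
    · rw [mulVec_zero, h₂.resolve_left (by simp)]
    have hb : b ≠ 0 := fun h => hu (dotProduct_self_eq_zero.1 h)
    ext i
    simp only [sub_mulVec, add_mulVec, smul_mulVec, vecMulVec_mulVec, Pi.sub_apply, Pi.add_apply,
      Pi.smul_apply, smul_eq_mul, op_smul_eq_smul]
    rw [horth, dotProduct_comm t₁ u₂, dotProduct_comm t₂ u₂, ← hb_def]
    field_simp
    ring

/-- The complex vector with real part `u` and imaginary part `v`. -/
def complexVec (u v : n → ℝ) : n → ℂ := fun i => (u i : ℂ) + Complex.I * v i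

theorem complexVec_re_im (s : n → ℂ) :
    complexVec (fun i => (s i).re) (fun i => (s i).im) = s := by
  ext i
  rw [complexVec, mul_comm, Complex.re_add_im]

variable [Fintype n]

theorem map_ofReal_mulVec_complexVec (Y : Matrix n n ℝ) (u v : n → ℝ) :
    Y.map Complex.ofReal *ᵥ complexVec u v = complexVec (Y *ᵥ u) (Y *ᵥ v) := by
  ext i
  simp only [mulVec, dotProduct, map_apply, complexVec, mul_add, Finset.sum_add_distrib,
    Complex.ofReal_sum, Complex.ofReal_mul, Finset.mul_sum]
  congr 1
  exact Finset.sum_congr rfl fun j _ => by ring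

/-- If `⟨s, t⟩ = 0`, then `Y s = t` is solvable by real symmetric matrices `Y` at least
approximately. This version assumes that `s = u₁ + j u₂` has orthogonal real and imaginary parts.
The equation can fail to have an exact solution if `u₂ = 0`: then `u₂` is replaced by a small
multiple of `t₂`. -/
theorem exists_tendsto_isSymm_mulVec_of_orthogonal (u₁ u₂ t₁ t₂ : n → ℝ) (h₁ : u₁ ≠ 0)
    (horth : u₁ ⬝ᵥ u₂ = 0) (hsymm : u₁ ⬝ᵥ t₂ = u₂ ⬝ᵥ t₁) :
    ∃ (Y : ℕ → Matrix n n ℝ) (w : ℕ → n → ℂ), (∀ k, (Y k).IsSymm) ∧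
      Tendsto w atTop (𝓝 (complexVec u₁ u₂)) ∧
      Tendsto (fun k => (Y k).map Complex.ofReal *ᵥ w k) atTop (𝓝 (complexVec t₁ t₂)) := by
  by_cases h₂ : u₂ ≠ 0 ∨ t₂ = 0
  · obtain ⟨Y, hY, hY₁, hY₂⟩ := exists_isSymm_mulVec_eq u₁ u₂ t₁ t₂ h₁ h₂ horth hsymm
    refine ⟨fun _ => Y, fun _ => complexVec u₁ u₂, fun _ => hY, tendsto_const_nhds, ?_⟩
    simp_rw [map_ofReal_mulVec_complexVec, hY₁, hY₂]
    exact tendsto_const_nhds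
  push Not at h₂
  obtain ⟨rfl, ht⟩ := h₂
  rw [zero_dotProduct] at hsymm
  have ha : u₁ ⬝ᵥ u₁ ≠ 0 := fun h => h₁ (dotProduct_self_eq_zero.1 h)
  set δ : ℕ → ℝ := fun k => 1 / ((k : ℝ) + 1)
  have hδ : Tendsto δ atTop (𝓝 0) := tendsto_one_div_add_atTop_nhds_zero_nat
  have hδ0 : ∀ k, δ k ≠ 0 := fun k => by positivity
  -- The correction of `t₂` restores the symmetry condition.
  set τ : ℕ → n → ℝ := fun k => t₂ + (δ k * (t₂ ⬝ᵥ t₁) / (u₁ ⬝ᵥ u₁)) • u₁ with hτ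
  have hex : ∀ k, ∃ Y : Matrix n n ℝ, Y.IsSymm ∧ Y *ᵥ u₁ = t₁ ∧ Y *ᵥ (δ k • t₂) = τ k := fun k => by
    refine exists_isSymm_mulVec_eq u₁ (δ k • t₂) t₁ (τ k) h₁
      (Or.inl (smul_ne_zero (hδ0 k) ht)) ?_ ?_
    · rw [dotProduct_smul, hsymm, smul_zero]
    · rw [hτ, dotProduct_add, hsymm, dotProduct_smul, smul_dotProduct, smul_eq_mul, smul_eq_mul]
      field_simp
      ring
  choose Y hY hY₁ hY₂ using hex
  refine ⟨Y, fun k => complexVec u₁ (δ k • t₂), hY, ?_, ?_⟩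
  · rw [tendsto_pi_nhds]
    intro i
    have h : Tendsto (fun k => (u₁ i : ℂ) + Complex.I * ((δ k * t₂ i : ℝ) : ℂ)) atTop
        (𝓝 ((u₁ i : ℂ) + Complex.I * ((0 * t₂ i : ℝ) : ℂ))) :=
      (((Complex.continuous_ofReal.tendsto _).comp (hδ.mul_const _)).const_mul _).const_add _
    simpa [complexVec] using h
  · simp_rw [map_ofReal_mulVec_complexVec, hY₁, hY₂]
    rw [tendsto_pi_nhds]
    intro i
    have h : Tendsto (fun k => (t₁ i : ℂ) + Complex.I *
        ((t₂ i + δ k * (t₂ ⬝ᵥ t₁) / (u₁ ⬝ᵥ u₁) * u₁ i : ℝ) : ℂ)) atTop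
        (𝓝 ((t₁ i : ℂ) + Complex.I *
          ((t₂ i + 0 * (t₂ ⬝ᵥ t₁) / (u₁ ⬝ᵥ u₁) * u₁ i : ℝ) : ℂ))) :=
      (((Complex.continuous_ofReal.tendsto _).comp
        ((((hδ.mul_const _).div_const _).mul_const _).const_add _)).const_mul _).const_add _
    simpa [complexVec, hτ] using h

/-- If `⟨s, t⟩ = 0`, then `(s, t)` is a limit of pairs `(w, Y w)` with `Y` real symmetric. -/
theorem exists_tendsto_isSymm_mulVec (s t : n → ℂ) (hs : s ≠ 0) (hst : star s ⬝ᵥ t = 0) :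
    ∃ (Y : ℕ → Matrix n n ℝ) (w : ℕ → n → ℂ), (∀ k, (Y k).IsSymm) ∧
      Tendsto w atTop (𝓝 s) ∧
      Tendsto (fun k => (Y k).map Complex.ofReal *ᵥ w k) atTop (𝓝 t) := by
  -- Multiplying by half the opposite phase of `sᵀ s` makes the real and imaginary parts orthogonal.
  set z := s ⬝ᵥ s with hz
  set ω : ℂ := Complex.exp (((-(z.arg / 2) : ℝ) : ℂ) * Complex.I) with hω
  have hω0 : ω ≠ 0 := Complex.exp_ne_zero _
  have hωn : star ω * ω = 1 := by
    rw [Complex.star_def, Complex.conj_mul', hω, Complex.norm_exp_ofReal_mul_I]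
    simp
  have hωz : ω ^ 2 * z = (‖z‖ : ℂ) := by
    conv_lhs => rw [← Complex.norm_mul_exp_arg_mul_I z]
    rw [mul_left_comm, hω, ← Complex.exp_nat_mul, ← Complex.exp_add]
    have : ((2 : ℕ) : ℂ) * (((-(z.arg / 2) : ℝ) : ℂ) * Complex.I) + z.arg * Complex.I = 0 := by
      push_cast
      ring
    rw [this, Complex.exp_zero, mul_one]
  set s' := ω • s with hs'
  set t' := ω • t with ht'
  have hs'0 : s' ≠ 0 := smul_ne_zero hω0 hs
  have hss : s' ⬝ᵥ s' = (‖z‖ : ℂ) := by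
    rw [hs', smul_dotProduct, dotProduct_smul, smul_smul, smul_eq_mul, ← hz, ← hωz]
    ring
  have hst' : star s' ⬝ᵥ t' = 0 := by
    rw [hs', ht', star_smul, smul_dotProduct, dotProduct_smul, hst, smul_zero, smul_zero]
  set u₁ : n → ℝ := fun i => (s' i).re
  set u₂ : n → ℝ := fun i => (s' i).im
  have hre : u₁ ⬝ᵥ u₁ - u₂ ⬝ᵥ u₂ = ‖z‖ := by
    have h := congrArg Complex.re hss
    simpa [dotProduct, Complex.re_sum, Finset.sum_sub_distrib] using h
  have him : u₁ ⬝ᵥ u₂ = 0 := by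
    have h := congrArg Complex.im hss
    simp only [dotProduct, Complex.im_sum, Complex.mul_im, Finset.sum_add_distrib,
      Complex.ofReal_im] at h
    have hc : ∑ i, (s' i).im * (s' i).re = ∑ i, (s' i).re * (s' i).im :=
      Finset.sum_congr rfl fun i _ => mul_comm _ _
    rw [hc] at h
    exact (by linarith : ∑ i, (s' i).re * (s' i).im = 0)
  have hu₁ : u₁ ≠ 0 := by
    intro h0
    rw [h0, zero_dotProduct] at hre
    have hnn : 0 ≤ u₂ ⬝ᵥ u₂ := Finset.sum_nonneg fun i _ => mul_self_nonneg _
    have h2 : u₂ = 0 := dotProduct_self_eq_zero.1 (by linarith [norm_nonneg z])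
    exact hs'0 (funext fun i => Complex.ext (congrFun h0 i) (congrFun h2 i))
  have hsymm : u₁ ⬝ᵥ (fun i => (t' i).im) = u₂ ⬝ᵥ (fun i => (t' i).re) := by
    have h := congrArg Complex.im hst'
    simp only [dotProduct, Complex.im_sum, Complex.mul_im, Finset.sum_add_distrib, Pi.star_apply,
      Complex.star_def, Complex.conj_re, Complex.conj_im, neg_mul, Finset.sum_neg_distrib,
      Complex.zero_im] at h
    simp only [dotProduct]
    linarith
  obtain ⟨Y, w, hY, hw, hYw⟩ := exists_tendsto_isSymm_mulVec_of_orthogonal u₁ u₂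
    (fun i => (t' i).re) (fun i => (t' i).im) hu₁ him hsymm
  rw [complexVec_re_im s'] at hw
  rw [complexVec_re_im t'] at hYw
  have hback : ∀ v : n → ℂ, star ω • ω • v = v := fun v => by rw [smul_smul, hωn, one_smul]
  refine ⟨Y, fun k => star ω • w k, hY, ?_, ?_⟩
  · simpa only [hs', hback] using hw.const_smul (star ω)
  · simpa only [ht', hback, mulVec_smul] using hYw.const_smul (star ω)

/-! ### The best reciprocal lossless network -/

theorem norm_toLp_sq (v : n → ℂ) : ‖toLp 2 v‖ ^ 2 = (star v ⬝ᵥ v).re := by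
  rw [← inner_self_eq_norm_sq (𝕜 := ℂ), EuclideanSpace.inner_toLp_toLp, dotProduct_comm]
  rfl

theorem star_dotProduct_self_eq (v : n → ℂ) : star v ⬝ᵥ v = ((‖toLp 2 v‖ ^ 2 : ℝ) : ℂ) := by
  rw [dotProduct_comm, ← EuclideanSpace.inner_toLp_toLp, inner_self_eq_norm_sq_to_K]
  norm_cast

theorem norm_dotProduct_le (p v : n → ℂ) : ‖p ⬝ᵥ v‖ ≤ ‖toLp 2 p‖ * ‖toLp 2 v‖ := by
  have h := norm_inner_le_norm (𝕜 := ℂ) (toLp 2 (star p)) (toLp 2 v)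
  rw [EuclideanSpace.inner_toLp_toLp, star_star, dotProduct_comm] at h
  have hp : ‖toLp 2 (star p)‖ = ‖toLp 2 p‖ := by
    simp [EuclideanSpace.norm_eq]
  rwa [hp] at h

/-- Losslessness: `(1 - jY)(1 + jY)⁻¹` is an isometry for a real symmetric `Y`. -/
theorem norm_sub_I_smul_mulVec (Y : Matrix n n ℝ) (hY : Y.IsSymm) (w : n → ℂ) :
    ‖toLp 2 (w - Complex.I • (Y.map Complex.ofReal *ᵥ w))‖ =
      ‖toLp 2 (w + Complex.I • (Y.map Complex.ofReal *ᵥ w))‖ := by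
  have hH : (Y.map Complex.ofReal).IsHermitian := by
    ext i j
    simp [hY.apply i j]
  have him : (inner ℂ (toLp 2 w) (toLp 2 (Y.map Complex.ofReal *ᵥ w))).im = 0 := by
    rw [EuclideanSpace.inner_toLp_toLp, dotProduct_comm]
    exact hH.im_star_dotProduct_mulVec_self w
  have hcross : (inner ℂ (toLp 2 w) (Complex.I • toLp 2 (Y.map Complex.ofReal *ᵥ w))).re = 0 := by
    rw [inner_smul_right]
    simp [him]
  refine (sq_eq_sq₀ (norm_nonneg _) (norm_nonneg _)).1 ?_
  rw [toLp_sub, toLp_add, toLp_smul, norm_sub_sq (𝕜 := ℂ), norm_add_sq (𝕜 := ℂ)]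
  simp only [RCLike.re_to_complex, hcross]
  ring

variable [DecidableEq n]

theorem one_add_I_smul_mulVec (Y : Matrix n n ℝ) (w : n → ℂ) :
    (1 + Complex.I • Y.map Complex.ofReal) *ᵥ w =
      w + Complex.I • (Y.map Complex.ofReal *ᵥ w) := by
  rw [add_mulVec, one_mulVec, smul_mulVec]

theorem isUnit_one_add_I_smul (Y : Matrix n n ℝ) (hY : Y.IsSymm) :
    IsUnit (1 + Complex.I • Y.map Complex.ofReal) := by
  rw [← mulVec_injective_iff_isUnit]
  refine (injective_iff_map_eq_zero (mulVecLin (1 + Complex.I • Y.map Complex.ofReal))).2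
    fun w hw => ?_
  rw [mulVecLin_apply, one_add_I_smul_mulVec] at hw
  have h := norm_sub_I_smul_mulVec Y hY w
  rw [hw, toLp_zero, norm_zero, norm_eq_zero] at h
  have h' : w - Complex.I • (Y.map Complex.ofReal *ᵥ w) = 0 := (toLp_eq_zero 2).1 h
  have h2 : (2 : ℂ) • w = 0 := by
    rw [two_smul]
    calc w + w = (w + Complex.I • (Y.map Complex.ofReal *ᵥ w))
          + (w - Complex.I • (Y.map Complex.ofReal *ᵥ w)) := by abel
      _ = 0 := by rw [hw, h', add_zero]
  exact (smul_eq_zero.1 h2).resolve_left two_ne_zero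

theorem norm_dotProduct_inv_le (Y : Matrix n n ℝ) (hY : Y.IsSymm) (p q : n → ℂ) :
    ‖p ⬝ᵥ (1 + Complex.I • Y.map Complex.ofReal)⁻¹ *ᵥ q‖ ≤
      (‖p ⬝ᵥ q‖ + ‖toLp 2 p‖ * ‖toLp 2 q‖) / 2 := by
  set Z := 1 + Complex.I • Y.map Complex.ofReal with hZ
  set w := Z⁻¹ *ᵥ q with hw
  have hu : IsUnit Z.det := (isUnit_iff_isUnit_det _).1 (isUnit_one_add_I_smul Y hY)
  have hq : q = w + Complex.I • (Y.map Complex.ofReal *ᵥ w) := by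
    rw [← one_add_I_smul_mulVec, hw, mulVec_mulVec, mul_nonsing_inv _ hu, one_mulVec]
  set v := w - Complex.I • (Y.map Complex.ofReal *ᵥ w) with hv
  have hvn : ‖toLp 2 v‖ = ‖toLp 2 q‖ := by
    rw [hq]
    exact norm_sub_I_smul_mulVec Y hY w
  have hsum : p ⬝ᵥ q + p ⬝ᵥ v = 2 * (p ⬝ᵥ w) := by
    rw [← dotProduct_add, hq, hv, add_add_sub_cancel, dotProduct_add, two_mul]
  have h2 : 2 * ‖p ⬝ᵥ w‖ ≤ ‖p ⬝ᵥ q‖ + ‖toLp 2 p‖ * ‖toLp 2 q‖ := by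
    calc 2 * ‖p ⬝ᵥ w‖ = ‖p ⬝ᵥ q + p ⬝ᵥ v‖ := by rw [hsum, norm_mul]; simp
      _ ≤ ‖p ⬝ᵥ q‖ + ‖p ⬝ᵥ v‖ := norm_add_le _ _
      _ ≤ ‖p ⬝ᵥ q‖ + ‖toLp 2 p‖ * ‖toLp 2 q‖ := by
        rw [← hvn]
        exact add_le_add le_rfl (norm_dotProduct_le p v)
  linarith

/-- The bound `norm_dotProduct_inv_le` is sharp. Equality would need `(1 - jY)(1 + jY)⁻¹` to send
`q` to the multiple `y` of `star p` that has the length of `q` and makes `pᵀ y` and `pᵀ q` have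
equal phases, that is, `Y (q + y) = j (y - q)`. Such a `Y` exists approximately, because
`⟨q + y, y - q⟩ = 0`. -/
theorem exists_tendsto_norm_dotProduct_inv (p q : n → ℂ) :
    ∃ Y : ℕ → Matrix n n ℝ, (∀ k, (Y k).IsSymm) ∧
      Tendsto (fun k => ‖p ⬝ᵥ (1 + Complex.I • (Y k).map Complex.ofReal)⁻¹ *ᵥ q‖) atTop
        (𝓝 ((‖p ⬝ᵥ q‖ + ‖toLp 2 p‖ * ‖toLp 2 q‖) / 2)) := by
  by_cases hpq : p = 0 ∨ q = 0
  · refine ⟨fun _ => 0, fun _ => isSymm_zero, ?_⟩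
    rcases hpq with rfl | rfl <;> simp
  push Not at hpq
  obtain ⟨hp, hq⟩ := hpq
  have hpn : 0 < ‖toLp 2 p‖ := norm_pos_iff.2 fun h => hp ((toLp_eq_zero 2).1 h)
  have hqn : 0 < ‖toLp 2 q‖ := norm_pos_iff.2 fun h => hq ((toLp_eq_zero 2).1 h)
  set a := ‖toLp 2 p‖
  set b := ‖toLp 2 q‖
  set θ : ℂ := Complex.exp ((p ⬝ᵥ q).arg * Complex.I) with hθ
  have hθz : p ⬝ᵥ q = ‖p ⬝ᵥ q‖ * θ := (Complex.norm_mul_exp_arg_mul_I _).symm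
  have hθ1 : ‖θ‖ = 1 := Complex.norm_exp_ofReal_mul_I _
  have hθθ : star θ * θ = 1 := by
    rw [Complex.star_def, Complex.conj_mul', hθ1]
    simp
  set κ : ℂ := θ * ((b / a : ℝ) : ℂ) with hκ
  set y : n → ℂ := κ • star p with hy
  have ha : (a : ℂ) ≠ 0 := by exact_mod_cast hpn.ne'
  have hpy : p ⬝ᵥ y = θ * ((a * b : ℝ) : ℂ) := by
    rw [hy, dotProduct_smul, dotProduct_comm, star_dotProduct_self_eq, hκ, smul_eq_mul]
    change _ * (((a ^ 2 : ℝ)) : ℂ) = _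
    push_cast
    field_simp
  have hstar : star κ = star θ * ((b / a : ℝ) : ℂ) := by
    rw [hκ, star_mul', Complex.star_def, Complex.conj_ofReal]
  have hyq : star y ⬝ᵥ q = ((b / a * ‖p ⬝ᵥ q‖ : ℝ) : ℂ) := by
    rw [hy, star_smul, star_star, smul_dotProduct, smul_eq_mul, hstar]
    push_cast
    linear_combination (b / a * ‖p ⬝ᵥ q‖ : ℂ) * hθθ + star θ * (b / a) * hθz
  have hqy : star q ⬝ᵥ y = ((b / a * ‖p ⬝ᵥ q‖ : ℝ) : ℂ) := by
    rw [star_dotProduct, hyq, Complex.star_def, Complex.conj_ofReal]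
  have hyy : star y ⬝ᵥ y = ((b ^ 2 : ℝ) : ℂ) := by
    rw [hy, star_smul, star_star, smul_dotProduct, ← hy, hpy, smul_eq_mul, hstar]
    push_cast
    field_simp
    linear_combination (b : ℂ) ^ 2 * hθθ
  set s : n → ℂ := (1 / 2 : ℂ) • (q + y) with hs_def
  set t : n → ℂ := (Complex.I / 2) • (y - q) with ht_def
  have hps : p ⬝ᵥ s = θ * (((‖p ⬝ᵥ q‖ + a * b) / 2 : ℝ) : ℂ) := by
    rw [hs_def, dotProduct_smul, dotProduct_add, hpy, smul_eq_mul]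
    nth_rw 1 [hθz]
    push_cast
    ring
  have hnorm : ‖p ⬝ᵥ s‖ = (‖p ⬝ᵥ q‖ + a * b) / 2 := by
    rw [hps, norm_mul, hθ1, one_mul, Complex.norm_real, Real.norm_of_nonneg (by positivity)]
  have hs : s ≠ 0 := by
    intro h0
    rw [h0, dotProduct_zero, norm_zero] at hnorm
    have : 0 < a * b := mul_pos hpn hqn
    linarith [norm_nonneg (p ⬝ᵥ q)]
  have hst : star s ⬝ᵥ t = 0 := by
    rw [hs_def, ht_def, star_smul, smul_dotProduct, dotProduct_smul, star_add, add_dotProduct,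
      dotProduct_sub, dotProduct_sub, hyq, hqy, hyy, star_dotProduct_self_eq]
    change _ • _ • ((_ - ((b ^ 2 : ℝ) : ℂ)) + _) = _
    rw [show ∀ c d : ℂ, c - d + (d - c) = 0 from fun c d => by ring, smul_zero, smul_zero]
  obtain ⟨Y, w, hY, hw, hYw⟩ := exists_tendsto_isSymm_mulVec s t hs hst
  refine ⟨Y, hY, ?_⟩
  -- The defect of `w k` as a solution of `(1 + j Y k) w = q`.
  set e : ℕ → n → ℂ := fun k => q - (w k + Complex.I • ((Y k).map Complex.ofReal *ᵥ w k)) with he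
  have he0 : Tendsto e atTop (𝓝 0) := by
    have h := (hw.add (hYw.const_smul Complex.I)).const_sub q
    have h0 : q - (s + Complex.I • t) = 0 := by
      ext i
      simp only [hs_def, ht_def, Pi.sub_apply, Pi.add_apply, Pi.smul_apply, smul_eq_mul,
        Pi.zero_apply]
      linear_combination (-(y i - q i) / 2) * Complex.I_mul_I
    rwa [h0] at h
  have hen : Tendsto (fun k => ‖toLp 2 p‖ * ‖toLp 2 (e k)‖) atTop (𝓝 0) := by
    have hc : Continuous fun v : n → ℂ => ‖toLp 2 p‖ * ‖toLp 2 v‖ :=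
      continuous_const.mul (PiLp.continuous_toLp 2 _).norm
    have h := (hc.tendsto 0).comp he0
    simpa [Function.comp_def] using h
  have hdiff : ∀ k, ‖p ⬝ᵥ (1 + Complex.I • (Y k).map Complex.ofReal)⁻¹ *ᵥ q - p ⬝ᵥ w k‖ ≤
      ‖toLp 2 p‖ * ‖toLp 2 (e k)‖ := fun k => by
    set Z := 1 + Complex.I • (Y k).map Complex.ofReal
    have hu : IsUnit Z.det := (isUnit_iff_isUnit_det _).1 (isUnit_one_add_I_smul (Y k) (hY k))
    have hwk : w k = Z⁻¹ *ᵥ (w k + Complex.I • ((Y k).map Complex.ofReal *ᵥ w k)) := by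
      rw [← one_add_I_smul_mulVec, mulVec_mulVec, nonsing_inv_mul _ hu, one_mulVec]
    have heq : p ⬝ᵥ Z⁻¹ *ᵥ q - p ⬝ᵥ w k = p ⬝ᵥ Z⁻¹ *ᵥ e k := by
      rw [he, mulVec_sub, dotProduct_sub, ← hwk]
    rw [heq]
    refine (norm_dotProduct_inv_le (Y k) (hY k) p (e k)).trans ?_
    have := norm_dotProduct_le p (e k)
    linarith
  have hlim : Tendsto (fun k => p ⬝ᵥ (1 + Complex.I • (Y k).map Complex.ofReal)⁻¹ *ᵥ q) atTop
      (𝓝 (p ⬝ᵥ s)) := by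
    have hpw : Tendsto (fun k => p ⬝ᵥ w k) atTop (𝓝 (p ⬝ᵥ s)) :=
      ((continuous_const.dotProduct continuous_id).tendsto s).comp hw
    have h := (squeeze_zero_norm hdiff hen).add hpw
    simpa using h
  simpa only [hnorm] using hlim.norm

/-- The supremum of the moduli of `pᵀ (S + jY)⁻¹ q` over all real symmetric `Y`, in closed form, for
a real positive definite `S`. -/
noncomputable def bestAmplitude (S : Matrix n n ℂ) (p q : n → ℂ) : ℝ :=
  (‖p ⬝ᵥ S⁻¹ *ᵥ q‖ + √((star p ⬝ᵥ S⁻¹ *ᵥ p).re * (star q ⬝ᵥ S⁻¹ *ᵥ q).re)) / 2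

open scoped MatrixOrder in
theorem exists_transpose_mul_self_eq (S : Matrix n n ℝ) (hS : S.PosDef) :
    ∃ B : Matrix n n ℝ, IsUnit B ∧ S = Bᵀ * B := by
  obtain ⟨B, hB⟩ := CStarAlgebra.nonneg_iff_eq_star_mul_self.1 hS.posSemidef.nonneg
  rw [star_eq_conjTranspose, conjTranspose_eq_transpose_of_trivial] at hB
  refine ⟨B, ?_, hB⟩
  have h := (isUnit_iff_isUnit_det _).1 hS.isUnit
  rw [hB, det_mul] at h
  exact (isUnit_iff_isUnit_det _).2 (isUnit_of_mul_isUnit_right h)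

section Congruence

variable {S B : Matrix n n ℝ}

/-- A congruence by a real root `B` of `S` turns `S + jY` into `1 + jY'`. -/
theorem add_I_smul_congruence (hSB : S = Bᵀ * B) (Y : Matrix n n ℝ) :
    S.map Complex.ofReal + Complex.I • (Bᵀ * Y * B).map Complex.ofReal =
      (B.map Complex.ofReal)ᵀ * (1 + Complex.I • Y.map Complex.ofReal) * B.map Complex.ofReal := by
  have hmul : ∀ M M' : Matrix n n ℝ,
      (M * M').map Complex.ofReal = M.map Complex.ofReal * M'.map Complex.ofReal :=
    fun M M' => Matrix.map_mul (f := Complex.ofRealHom)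
  rw [hSB, hmul, hmul, hmul, ← transpose_map, mul_add, mul_one, add_mul, Matrix.mul_smul,
    Matrix.smul_mul]

theorem dotProduct_congruence_inv (hSB : S = Bᵀ * B) (Y : Matrix n n ℝ) (p q : n → ℂ) :
    p ⬝ᵥ (S.map Complex.ofReal + Complex.I • (Bᵀ * Y * B).map Complex.ofReal)⁻¹ *ᵥ q =
      ((B.map Complex.ofReal)ᵀ⁻¹ *ᵥ p) ⬝ᵥ
        (1 + Complex.I • Y.map Complex.ofReal)⁻¹ *ᵥ ((B.map Complex.ofReal)ᵀ⁻¹ *ᵥ q) := by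
  rw [add_I_smul_congruence hSB, Matrix.mul_inv_rev, Matrix.mul_inv_rev, ← mulVec_mulVec,
    ← mulVec_mulVec, dotProduct_mulVec, ← mulVec_transpose, transpose_nonsing_inv]

theorem dotProduct_inv_eq (hSB : S = Bᵀ * B) (p q : n → ℂ) :
    p ⬝ᵥ (S.map Complex.ofReal)⁻¹ *ᵥ q =
      ((B.map Complex.ofReal)ᵀ⁻¹ *ᵥ p) ⬝ᵥ ((B.map Complex.ofReal)ᵀ⁻¹ *ᵥ q) := by
  simpa using dotProduct_congruence_inv hSB 0 p q

theorem re_star_dotProduct_inv_eq (hSB : S = Bᵀ * B) (p : n → ℂ) :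
    (star p ⬝ᵥ (S.map Complex.ofReal)⁻¹ *ᵥ p).re =
      ‖toLp 2 ((B.map Complex.ofReal)ᵀ⁻¹ *ᵥ p)‖ ^ 2 := by
  have hreal : (B.map Complex.ofReal)ᵀ⁻¹ᴴ = (B.map Complex.ofReal)ᵀ⁻¹ᵀ := by
    rw [conjTranspose_nonsing_inv, transpose_nonsing_inv, transpose_transpose]
    congr 1
    ext i j
    simp
  rw [norm_toLp_sq, dotProduct_inv_eq hSB, star_mulVec, hreal, vecMul_transpose]

theorem bestAmplitude_eq (hSB : S = Bᵀ * B) (p q : n → ℂ) :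
    bestAmplitude (S.map Complex.ofReal) p q =
      (‖((B.map Complex.ofReal)ᵀ⁻¹ *ᵥ p) ⬝ᵥ ((B.map Complex.ofReal)ᵀ⁻¹ *ᵥ q)‖
        + ‖toLp 2 ((B.map Complex.ofReal)ᵀ⁻¹ *ᵥ p)‖
          * ‖toLp 2 ((B.map Complex.ofReal)ᵀ⁻¹ *ᵥ q)‖) / 2 := by
  rw [bestAmplitude, re_star_dotProduct_inv_eq hSB, re_star_dotProduct_inv_eq hSB,
    dotProduct_inv_eq hSB, ← mul_pow, Real.sqrt_sq (by positivity)]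

theorem exists_isSymm_congruence (hB : IsUnit B) (Y : Matrix n n ℝ) (hY : Y.IsSymm) :
    ∃ Y' : Matrix n n ℝ, Y'.IsSymm ∧ Y = Bᵀ * Y' * B := by
  have hdet : IsUnit B.det := (isUnit_iff_isUnit_det _).1 hB
  refine ⟨B⁻¹ᵀ * Y * B⁻¹, ?_, ?_⟩
  · rw [IsSymm, transpose_mul, transpose_mul, transpose_transpose, hY.eq, mul_assoc]
  · rw [mul_assoc, mul_assoc, nonsing_inv_mul _ hdet, mul_one, ← mul_assoc, ← transpose_mul,
      nonsing_inv_mul _ hdet, transpose_one, one_mul]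

end Congruence

theorem isUnit_add_I_smul {S Y : Matrix n n ℝ} (hS : S.PosDef) (hY : Y.IsSymm) :
    IsUnit (S.map Complex.ofReal + Complex.I • Y.map Complex.ofReal) := by
  obtain ⟨B, hB, hSB⟩ := exists_transpose_mul_self_eq S hS
  obtain ⟨Y', hY', rfl⟩ := exists_isSymm_congruence hB Y hY
  have hBc : IsUnit (B.map Complex.ofReal) := hB.map Complex.ofRealHom.mapMatrix
  rw [add_I_smul_congruence hSB]
  exact ((isUnit_transpose _).2 hBc |>.mul (isUnit_one_add_I_smul Y' hY')).mul hBc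

theorem norm_dotProduct_add_I_smul_inv_le {S Y : Matrix n n ℝ} (hS : S.PosDef) (hY : Y.IsSymm)
    (p q : n → ℂ) :
    ‖p ⬝ᵥ (S.map Complex.ofReal + Complex.I • Y.map Complex.ofReal)⁻¹ *ᵥ q‖ ≤
      bestAmplitude (S.map Complex.ofReal) p q := by
  obtain ⟨B, hB, hSB⟩ := exists_transpose_mul_self_eq S hS
  obtain ⟨Y', hY', rfl⟩ := exists_isSymm_congruence hB Y hY
  rw [dotProduct_congruence_inv hSB, bestAmplitude_eq hSB]
  exact norm_dotProduct_inv_le Y' hY' _ _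

theorem exists_tendsto_bestAmplitude {S : Matrix n n ℝ} (hS : S.PosDef) (p q : n → ℂ) :
    ∃ Y : ℕ → Matrix n n ℝ, (∀ k, (Y k).IsSymm) ∧
      Tendsto (fun k => ‖p ⬝ᵥ (S.map Complex.ofReal
        + Complex.I • (Y k).map Complex.ofReal)⁻¹ *ᵥ q‖) atTop
        (𝓝 (bestAmplitude (S.map Complex.ofReal) p q)) := by
  obtain ⟨B, -, hSB⟩ := exists_transpose_mul_self_eq S hS
  obtain ⟨Y, hY, hlim⟩ := exists_tendsto_norm_dotProduct_inv
    ((B.map Complex.ofReal)ᵀ⁻¹ *ᵥ p) ((B.map Complex.ofReal)ᵀ⁻¹ *ᵥ q)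
  refine ⟨fun k => Bᵀ * Y k * B, fun k => ?_, ?_⟩
  · rw [IsSymm, transpose_mul, transpose_mul, transpose_transpose, (hY k).eq, ← mul_assoc]
  · simp_rw [dotProduct_congruence_inv hSB, bestAmplitude_eq hSB]
    exact hlim

end RIS

namespace RIS

open Filter Topology Matrix

/-! ### Gram matrices of function families on `[-1, 1]` -/

section Gram

variable {m n : Type*} [Fintype n]

/-- The Gram matrix of a family of functions on `[-1, 1]` for the probability measure `du / 2`. -/
noncomputable def gram (f : ℝ → n → ℂ) : Matrix n n ℂ :=
  Matrix.of fun i j => (1 / 2 : ℂ) * ∫ u in (-1 : ℝ)..1, f u i * star (f u j)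

theorem gram_mulVec (T : Matrix m n ℂ) (f : ℝ → n → ℂ) (hf : Continuous f) :
    gram (fun u => T *ᵥ f u) = T * gram f * Tᴴ := by
  have hfi : ∀ i, Continuous fun u => f u i := fun i => (continuous_apply i).comp hf
  have hc : ∀ i j (c : ℂ), Continuous fun u => c * (f u i * star (f u j)) := fun i j c =>
    continuous_const.mul ((hfi i).mul (hfi j).star)
  ext k l
  have h : ∀ u, (T *ᵥ f u) k * star ((T *ᵥ f u) l) =
      ∑ j, ∑ i, T k i * star (T l j) * (f u i * star (f u j)) := fun u => by
    simp only [mulVec, dotProduct, star_sum, star_mul', Finset.sum_mul_sum]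
    rw [Finset.sum_comm]
    exact Finset.sum_congr rfl fun j _ => Finset.sum_congr rfl fun i _ => by ring
  simp only [gram, of_apply, mul_apply, h, conjTranspose_apply]
  rw [intervalIntegral.integral_finsetSum fun j _ =>
    (continuous_finsetSum _ fun i _ => hc i j _).intervalIntegrable _ _, Finset.mul_sum]
  refine Finset.sum_congr rfl fun j _ => ?_
  rw [intervalIntegral.integral_finsetSum fun i _ => (hc i j _).intervalIntegrable _ _,
    Finset.mul_sum, Finset.sum_mul]
  refine Finset.sum_congr rfl fun i _ => ?_
  rw [intervalIntegral.integral_const_mul]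
  ring

theorem star_dotProduct_gram_mulVec (f : ℝ → n → ℂ) (hf : Continuous f) (v : n → ℂ) :
    star v ⬝ᵥ gram f *ᵥ v = ((1 / 2 * ∫ u in (-1 : ℝ)..1, ‖star v ⬝ᵥ f u‖ ^ 2 : ℝ) : ℂ) := by
  have h := congrFun (congrFun
    (gram_mulVec (Matrix.of fun _ : Unit => star v) f hf) ()) ()
  have hr : ((Matrix.of fun _ : Unit => star v) * gram f *
      (Matrix.of fun _ : Unit => star v)ᴴ) () () = star v ⬝ᵥ gram f *ᵥ v := by
    rw [Matrix.mul_assoc]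
    simp [mul_apply, mulVec, dotProduct, conjTranspose_apply]
  rw [← hr, ← h]
  simp only [gram, of_apply]
  push_cast
  rw [← intervalIntegral.integral_ofReal]
  congr 1
  refine intervalIntegral.integral_congr fun u _ => ?_
  change (star v ⬝ᵥ f u) * star (star v ⬝ᵥ f u) = _
  rw [Complex.star_def, Complex.mul_conj']
  push_cast
  rfl

end Gram

/-! ### The radiation resistance matrix -/

/-- The normalized real part of the array impedance, as a function of the phase step `e = kd`. -/
noncomputable def sincMatrix (N : ℕ) (e : ℝ) : Matrix (Fin N) (Fin N) ℝ :=
  Matrix.of fun i j => Real.sinc (e * ((i : ℝ) - j))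

/-- The response of the array to a plane wave whose direction has the cosine `x`. -/
noncomputable def planeWave (N : ℕ) (e x : ℝ) : Fin N → ℂ := fun n =>
  Complex.exp (-(Complex.I * (((n : ℝ) * e * x : ℝ) : ℂ)))

theorem continuous_planeWave (N : ℕ) (e : ℝ) : Continuous (planeWave N e) := by
  unfold planeWave
  fun_prop

theorem star_planeWave (N : ℕ) (e x : ℝ) : star (planeWave N e x) = planeWave N e (-x) := by
  ext n
  simp only [planeWave, Pi.star_apply, Complex.star_def, ← Complex.exp_conj, map_neg, map_mul,
    Complex.conj_I, Complex.conj_ofReal]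
  push_cast
  ring_nf

theorem half_integral_exp (c : ℝ) :
    (1 / 2 : ℂ) * ∫ u in (-1 : ℝ)..1, Complex.exp (-(Complex.I * ((c * u : ℝ) : ℂ))) =
      Real.sinc c := by
  rcases eq_or_ne c 0 with rfl | hc
  · norm_num
  · have hc' : -(Complex.I * c) ≠ 0 :=
      neg_ne_zero.2 (mul_ne_zero Complex.I_ne_zero (by exact_mod_cast hc))
    have h := integral_exp_mul_complex (a := -1) (b := 1) hc'
    have hrw : ∀ u : ℝ, Complex.exp (-(Complex.I * ((c * u : ℝ) : ℂ))) =
        Complex.exp (-(Complex.I * c) * u) := fun u => by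
      push_cast
      ring_nf
    simp_rw [hrw]
    rw [h, Real.sinc_of_ne_zero hc]
    push_cast
    have h1 : Complex.exp (-(Complex.I * c) * 1) = Complex.cos c - Complex.sin c * Complex.I := by
      rw [show -(Complex.I * c) * 1 = (-c : ℂ) * Complex.I by ring, Complex.exp_mul_I,
        Complex.cos_neg, Complex.sin_neg]
      ring
    have h2 : Complex.exp (-(Complex.I * c) * -1) = Complex.cos c + Complex.sin c * Complex.I := by
      rw [show -(Complex.I * c) * -1 = (c : ℂ) * Complex.I by ring, Complex.exp_mul_I]
    rw [h1, h2]
    have hcc : (c : ℂ) ≠ 0 := by exact_mod_cast hc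
    have hI := Complex.I_ne_zero
    field_simp
    ring

theorem gram_planeWave (N : ℕ) (e : ℝ) :
    gram (planeWave N e) = (sincMatrix N e).map Complex.ofReal := by
  ext i j
  simp only [gram, of_apply, map_apply, sincMatrix]
  rw [← half_integral_exp]
  congr 1
  refine intervalIntegral.integral_congr fun u _ => ?_
  change planeWave N e u i * star (planeWave N e u) j = _
  rw [star_planeWave, planeWave, planeWave, ← Complex.exp_add]
  push_cast
  ring_nf

/-- The plane waves from all directions span `ℂ^N`: they are the values of the polynomial curve
`z ↦ (1, z, …, z^(N-1))` at infinitely many points of the unit circle. -/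
theorem exists_dotProduct_planeWave_ne_zero (N : ℕ) {e : ℝ} (he : e ≠ 0) {v : Fin N → ℂ}
    (hv : v ≠ 0) : ∃ x ∈ Set.Icc (-1 : ℝ) 1, v ⬝ᵥ planeWave N e x ≠ 0 := by
  by_contra! hzero
  set z : ℝ → ℂ := fun x => Complex.exp (-(Complex.I * ((e * x : ℝ) : ℂ))) with hz
  set p : Polynomial ℂ := ∑ i : Fin N, Polynomial.monomial i (v i) with hp
  have hroot : ∀ x ∈ Set.Icc (-1 : ℝ) 1, p.IsRoot (z x) := fun x hx => by
    rw [Polynomial.IsRoot.def, ← hzero x hx, hp, Polynomial.eval_finsetSum]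
    refine Finset.sum_congr rfl fun i _ => ?_
    rw [Polynomial.eval_monomial, hz, ← Complex.exp_nat_mul, planeWave]
    push_cast
    ring_nf
  have hzc : Continuous z := by fun_prop
  have hnontriv : (z '' Set.Icc (-1 : ℝ) 1).Nontrivial := by
    set x : ℝ := min 1 (Real.pi / |e|) with hx
    have hxpos : 0 < x := lt_min one_pos (div_pos Real.pi_pos (abs_pos.2 he))
    refine ⟨z 0, ⟨0, by norm_num, rfl⟩, z x, ⟨x, ⟨by linarith, min_le_left _ _⟩, rfl⟩, ?_⟩
    intro h
    have h1 : (z x).re = 1 := by rw [← h]; simp [hz]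
    have h2 : Real.cos (|e| * x) = 1 := by
      rw [← h1, hz]
      change _ = (Complex.exp (-(Complex.I * ((e * x : ℝ) : ℂ)))).re
      rw [show -(Complex.I * ((e * x : ℝ) : ℂ)) = ((-(e * x) : ℝ) : ℂ) * Complex.I by
        push_cast; ring, Complex.exp_ofReal_mul_I_re, Real.cos_neg]
      rcases abs_choice e with h | h <;> rw [h]
      rw [neg_mul, Real.cos_neg]
    have hle : |e| * x ≤ Real.pi := by
      calc |e| * x ≤ |e| * (Real.pi / |e|) :=
            mul_le_mul_of_nonneg_left (min_le_right _ _) (abs_nonneg _)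
        _ = Real.pi := mul_div_cancel₀ _ (abs_pos.2 he).ne'
    have hpos : 0 < |e| * x := mul_pos (abs_pos.2 he) hxpos
    have h3 := (Real.cos_eq_one_iff_of_lt_of_lt (by linarith [Real.pi_pos])
      (by linarith [Real.pi_pos])).1 h2
    exact hpos.ne' h3
  have hinf : (z '' Set.Icc (-1 : ℝ) 1).Infinite :=
    ((isPreconnected_Icc).image z hzc.continuousOn).infinite_of_nontrivial hnontriv
  have hp0 : p = 0 := Polynomial.eq_zero_of_infinite_isRoot p
    (hinf.mono (by rintro _ ⟨x, hx, rfl⟩; exact hroot x hx))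
  apply hv
  ext i
  have hc : p.coeff i = v i := by
    rw [hp, Polynomial.finsetSum_coeff, Finset.sum_eq_single i]
    · simp
    · intro j _ hj
      rw [Polynomial.coeff_monomial, if_neg fun h => hj (Fin.ext h)]
    · simp
  rw [← hc, hp0]
  simp

theorem posDef_sincMatrix (N : ℕ) {e : ℝ} (he : e ≠ 0) : (sincMatrix N e).PosDef := by
  refine PosDef.of_dotProduct_mulVec_pos ?_ fun x hx => ?_
  · ext i j
    simp only [conjTranspose_apply, sincMatrix, of_apply, star_trivial]
    rw [← Real.sinc_neg]
    ring_nf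
  · set v : Fin N → ℂ := fun i => (x i : ℂ) with hv
    have hv0 : star v ≠ 0 := fun h => hx (funext fun i => by simpa [hv] using congrFun h i)
    have h := star_dotProduct_gram_mulVec (planeWave N e) (continuous_planeWave N e) v
    have hcast : star v ⬝ᵥ gram (planeWave N e) *ᵥ v =
        ((star x ⬝ᵥ sincMatrix N e *ᵥ x : ℝ) : ℂ) := by
      rw [gram_planeWave]
      simp [hv, dotProduct, mulVec]
    rw [hcast] at h
    rw [Complex.ofReal_injective h]
    have hcont : Continuous fun u => ‖star v ⬝ᵥ planeWave N e u‖ ^ 2 :=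
      ((continuous_const.dotProduct (continuous_planeWave N e)).norm).pow 2
    obtain ⟨c, hc, hc0⟩ := exists_dotProduct_planeWave_ne_zero N he hv0
    have := intervalIntegral.integral_pos (by norm_num : (-1 : ℝ) < 1) hcont.continuousOn
      (fun u _ => by positivity) ⟨c, hc, by positivity⟩
    positivity

/-! ### The kernel of the array for vanishing spacing -/

/-- The curve `((e^{-jex} - 1) / (-je))^m`, `m < N`, extended continuously to `e = 0` by the moment
curve `x^m`. -/
noncomputable def momentWave (N : ℕ) (e x : ℝ) : Fin N → ℂ := fun m =>
  (x * dslope Complex.exp 0 (-(Complex.I * e * x))) ^ (m : ℕ)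

theorem continuous_dslope_exp : Continuous (dslope Complex.exp 0) := by
  rw [← continuousOn_univ]
  exact (continuousOn_dslope univ_mem).2
    ⟨Complex.continuous_exp.continuousOn, Complex.differentiable_exp 0⟩

theorem continuous_momentWave_apply (N : ℕ) (m : Fin N) :
    Continuous fun q : ℝ × ℝ => momentWave N q.1 q.2 m := by
  have := continuous_dslope_exp
  unfold momentWave
  fun_prop

theorem continuous_momentWave (N : ℕ) (e : ℝ) : Continuous (momentWave N e) :=
  continuous_pi fun m => (continuous_momentWave_apply N m).comp (Continuous.prodMk_right e)

theorem momentWave_zero (N : ℕ) (x : ℝ) (m : Fin N) :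
    momentWave N 0 x m = (x : ℂ) ^ (m : ℕ) := by
  simp [momentWave, dslope_same]

/-- The change of basis from `momentWave` to `planeWave`. -/
noncomputable def binomialMatrix (N : ℕ) (e : ℝ) : Matrix (Fin N) (Fin N) ℂ :=
  Matrix.of fun n m => ((n : ℕ).choose m : ℂ) * (-(Complex.I * e)) ^ (m : ℕ)

theorem binomialMatrix_mulVec_momentWave (N : ℕ) (e x : ℝ) :
    binomialMatrix N e *ᵥ momentWave N e x = planeWave N e x := by
  ext n
  have hexp : Complex.exp (-(Complex.I * e * x)) =
      -(Complex.I * e) * (x * dslope Complex.exp 0 (-(Complex.I * e * x))) + 1 := by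
    have h := sub_smul_dslope Complex.exp 0 (-(Complex.I * e * x))
    rw [Complex.exp_zero, sub_zero, smul_eq_mul] at h
    linear_combination -h
  have hn : planeWave N e x n = Complex.exp (-(Complex.I * e * x)) ^ (n : ℕ) := by
    rw [planeWave, ← Complex.exp_nat_mul]
    push_cast
    ring_nf
  rw [hn, hexp, add_pow]
  simp only [mulVec, dotProduct, binomialMatrix, of_apply, momentWave, one_pow, mul_one]
  set y : ℂ := x * dslope Complex.exp 0 (-(Complex.I * e * x))
  rw [Fin.sum_univ_eq_sum_range (fun m => ((n : ℕ).choose m : ℂ) * (-(Complex.I * e)) ^ m * y ^ m)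
    N]
  symm
  refine Finset.sum_subset_zero_on_sdiff (Finset.range_mono n.2) (fun m hm => ?_) fun m _ => ?_
  · rw [Finset.mem_sdiff, Finset.mem_range, Finset.mem_range] at hm
    rw [Nat.choose_eq_zero_of_lt (by omega)]
    simp
  · rw [mul_pow]
    ring

theorem isUnit_det_binomialMatrix (N : ℕ) {e : ℝ} (he : e ≠ 0) :
    IsUnit (binomialMatrix N e).det := by
  have htri : (binomialMatrix N e).BlockTriangular OrderDual.toDual := fun i j hij => by
    have : (i : ℕ) < j := hij
    simp [binomialMatrix, Nat.choose_eq_zero_of_lt this]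
  rw [det_of_isLowerTriangular _ htri, isUnit_iff_ne_zero, Finset.prod_ne_zero_iff]
  intro i _
  simp [binomialMatrix, he]

/-- The kernel `w(x)ᴴ G⁻¹ w(y)` of the span of the functions in `momentWave`, with their Gram
matrix `G`. -/
noncomputable def arrayKernel (N : ℕ) (e x y : ℝ) : ℂ :=
  star (momentWave N e x) ⬝ᵥ (gram (momentWave N e))⁻¹ *ᵥ momentWave N e y

/-- The kernel does not depend on the basis of the span. -/
theorem star_planeWave_dotProduct_inv (N : ℕ) {e : ℝ} (he : e ≠ 0) (x y : ℝ) :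
    star (planeWave N e x) ⬝ᵥ ((sincMatrix N e).map Complex.ofReal)⁻¹ *ᵥ planeWave N e y =
      arrayKernel N e x y := by
  have hT := isUnit_det_binomialMatrix N he
  have hC : (sincMatrix N e).map Complex.ofReal =
      binomialMatrix N e * gram (momentWave N e) * (binomialMatrix N e)ᴴ := by
    rw [← gram_planeWave, ← gram_mulVec _ _ (continuous_momentWave N e)]
    simp_rw [binomialMatrix_mulVec_momentWave]
  have hw : ∀ z, (binomialMatrix N e)⁻¹ *ᵥ planeWave N e z = momentWave N e z := fun z => by
    rw [← binomialMatrix_mulVec_momentWave, mulVec_mulVec, nonsing_inv_mul _ hT, one_mulVec]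
  rw [hC, Matrix.mul_inv_rev, Matrix.mul_inv_rev, ← mulVec_mulVec, ← mulVec_mulVec, hw,
    dotProduct_mulVec, ← conjTranspose_nonsing_inv, ← star_mulVec, hw, arrayKernel]

theorem continuous_gram_momentWave (N : ℕ) : Continuous fun e => gram (momentWave N e) := by
  refine continuous_matrix fun i j => ?_
  simp only [gram, of_apply]
  refine continuous_const.mul ?_
  refine intervalIntegral.continuous_parametric_intervalIntegral_of_continuous' ?_ _ _
  exact (continuous_momentWave_apply N i).mul (continuous_momentWave_apply N j).star

/-- The orthonormal Legendre polynomials `√(2i+1) P_i`, as rows of coefficients. -/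
noncomputable def legendreMatrix (N : ℕ) : Matrix (Fin N) (Fin N) ℂ :=
  Matrix.of fun i m => ((√(2 * (i : ℕ) + 1) * (legendre i).coeff m : ℝ) : ℂ)

theorem legendreMatrix_mulVec (N : ℕ) (x : ℝ) (i : Fin N) :
    (legendreMatrix N *ᵥ momentWave N 0 x) i =
      ((√(2 * (i : ℕ) + 1) * (legendre i).eval x : ℝ) : ℂ) := by
  simp only [mulVec, dotProduct, momentWave_zero, legendreMatrix, of_apply]
  rw [Polynomial.eval_eq_sum_range' ((natDegree_legendre_le i).trans_lt i.2),
    ← Fin.sum_univ_eq_sum_range (fun m => (legendre i).coeff m * x ^ m) N]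
  push_cast
  rw [Finset.mul_sum]
  exact Finset.sum_congr rfl fun m _ => by ring

theorem legendreMatrix_mul_gram (N : ℕ) :
    legendreMatrix N * gram (momentWave N 0) * (legendreMatrix N)ᴴ = 1 := by
  rw [← gram_mulVec _ _ (continuous_momentWave N 0)]
  ext i j
  simp only [gram, of_apply, legendreMatrix_mulVec, Complex.star_def, Complex.conj_ofReal,
    ← Complex.ofReal_mul]
  rw [intervalIntegral.integral_ofReal]
  have h : ∀ x : ℝ, √(2 * (i : ℕ) + 1) * (legendre i).eval x *
      (√(2 * (j : ℕ) + 1) * (legendre j).eval x) = √(2 * (i : ℕ) + 1) * √(2 * (j : ℕ) + 1) *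
        ((legendre i).eval x * (legendre j).eval x) := fun x => by ring
  simp_rw [h]
  rw [intervalIntegral.integral_const_mul]
  rcases eq_or_ne i j with rfl | hij
  · rw [Real.mul_self_sqrt (by positivity), integral_legendre_sq, one_apply_eq]
    norm_num
  · rw [integral_legendre_mul_of_ne fun h => hij (Fin.ext h), one_apply_ne hij]
    simp

theorem gram_momentWave_zero_mul (N : ℕ) :
    gram (momentWave N 0) * ((legendreMatrix N)ᴴ * legendreMatrix N) = 1 := by
  have h := legendreMatrix_mul_gram N
  rw [Matrix.mul_assoc] at h
  rw [← Matrix.mul_assoc]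
  exact mul_eq_one_comm.1 h

/-- For vanishing spacing the array kernel is the Christoffel–Darboux kernel of the Legendre
polynomials. -/
theorem arrayKernel_zero (N : ℕ) (x y : ℝ) :
    arrayKernel N 0 x y = ((∑ i ∈ Finset.range N,
      (2 * i + 1) * ((legendre i).eval x * (legendre i).eval y) : ℝ) : ℂ) := by
  rw [arrayKernel, inv_eq_right_inv (gram_momentWave_zero_mul N), ← mulVec_mulVec,
    dotProduct_mulVec, ← star_mulVec,
    ← Fin.sum_univ_eq_sum_range
      (fun i => (2 * i + 1 : ℝ) * ((legendre i).eval x * (legendre i).eval y)) N,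
    dotProduct, Complex.ofReal_sum]
  refine Finset.sum_congr rfl fun i _ => ?_
  rw [Pi.star_apply, legendreMatrix_mulVec, legendreMatrix_mulVec, Complex.star_def,
    Complex.conj_ofReal, ← Complex.ofReal_mul]
  have hs : √(2 * (i : ℕ) + 1 : ℝ) * √(2 * (i : ℕ) + 1) = 2 * (i : ℕ) + 1 :=
    Real.mul_self_sqrt (by positivity)
  congr 1
  linear_combination (legendre i).eval x * (legendre i).eval y * hs

theorem continuousAt_arrayKernel (N : ℕ) (x y : ℝ) :
    ContinuousAt (fun e => arrayKernel N e x y) 0 := by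
  have hwave : ∀ z, Continuous fun e => momentWave N e z := fun z =>
    continuous_pi fun m => (continuous_momentWave_apply N m).comp (Continuous.prodMk_left z)
  have hG := continuous_gram_momentWave N
  have hdet : (gram (momentWave N 0)).det ≠ 0 := by
    have h := congrArg det (gram_momentWave_zero_mul N)
    rw [det_mul, det_one] at h
    exact left_ne_zero_of_mul_eq_one h
  have hinv : ContinuousAt (fun e => (gram (momentWave N e))⁻¹) 0 := by
    simp only [inv_def, Ring.inverse_eq_inv']
    exact (hG.matrix_det.continuousAt.inv₀ hdet).smul hG.matrix_adjugate.continuousAt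
  simp only [arrayKernel, dotProduct, mulVec]
  refine tendsto_finsetSum _ fun i _ => Tendsto.mul ?_ (tendsto_finsetSum _ fun j _ =>
    Tendsto.mul ?_ ?_)
  · exact ((continuous_apply i).comp (hwave x).star).continuousAt
  · exact ((continuous_id.matrix_elem i j).tendsto _).comp hinv
  · exact ((continuous_apply j).comp (hwave y)).continuousAt

end RIS

namespace RIS

open Filter Topology Matrix

/-! ### The array gain -/

/-- The reactance of the array, the imaginary part of its impedance matrix. -/
noncomputable def arrayReactance (N : ℕ) (R e : ℝ) : Matrix (Fin N) (Fin N) ℝ :=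
  Matrix.of fun i j =>
    if i = j then 0 else R * Real.cos (e * |(i : ℝ) - j|) / (e * |(i : ℝ) - j|)

theorem isSymm_arrayReactance (N : ℕ) (R e : ℝ) : (arrayReactance N R e).IsSymm := by
  ext i j
  simp only [transpose_apply, arrayReactance, of_apply, abs_sub_comm (j : ℝ), eq_comm (a := j)]

theorem phaseStep_pos {lam d : ℝ} (hlam : 0 < lam) (hd : 0 < d) : 0 < phaseStep lam d := by
  have := Real.pi_pos
  unfold phaseStep
  positivity

theorem arrayImpedance_eq (N : ℕ) (R : ℝ) {lam d : ℝ} (hlam : 0 < lam) (hd : 0 < d) :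
    arrayImpedance N R lam d = (R • sincMatrix N (phaseStep lam d)).map Complex.ofReal
      + Complex.I • (arrayReactance N R (phaseStep lam d)).map Complex.ofReal := by
  have he := phaseStep_pos hlam hd
  ext i j
  simp only [arrayImpedance, sincMatrix, arrayReactance, of_apply, Matrix.add_apply,
    Matrix.smul_apply, map_apply, smul_eq_mul]
  rcases eq_or_ne i j with rfl | hij
  · simp
  have hsub : (i : ℝ) - j ≠ 0 := sub_ne_zero.2 fun h => hij (Fin.ext (by exact_mod_cast h))
  set e := phaseStep lam d
  have hsinc : Real.sinc (e * ((i : ℝ) - j)) = Real.sinc (e * |(i : ℝ) - j|) := by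
    rcases abs_choice ((i : ℝ) - j) with h | h <;> rw [h]
    rw [mul_neg, Real.sinc_neg]
  have hx : e * |(i : ℝ) - j| ≠ 0 := mul_ne_zero he.ne' (abs_ne_zero.2 hsub)
  rw [if_neg hij, if_neg hij, hsinc]
  set x := e * |(i : ℝ) - j|
  rw [Real.sinc_of_ne_zero hx, show -(Complex.I * (x : ℂ)) = (-x : ℂ) * Complex.I by ring,
    Complex.exp_mul_I, Complex.cos_neg, Complex.sin_neg]
  have hxc : (x : ℂ) ≠ 0 := by exact_mod_cast hx
  have hI := Complex.I_ne_zero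
  push_cast
  field_simp
  linear_combination (-(R : ℂ) * Complex.cos x) * Complex.I_sq

theorem loadedImpedance_eq (N : ℕ) (R : ℝ) {lam d : ℝ} (hlam : 0 < lam) (hd : 0 < d)
    (X : Matrix (Fin N) (Fin N) ℝ) :
    loadedImpedance N R lam d X = (R • sincMatrix N (phaseStep lam d)).map Complex.ofReal
      + Complex.I • (arrayReactance N R (phaseStep lam d) + X).map Complex.ofReal := by
  have hadd : (arrayReactance N R (phaseStep lam d) + X).map Complex.ofReal =
      (arrayReactance N R (phaseStep lam d)).map Complex.ofReal + X.map Complex.ofReal :=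
    Matrix.map_add _ Complex.ofReal_add _ _
  rw [loadedImpedance, arrayImpedance_eq N R hlam hd, hadd, smul_add, add_assoc]

theorem posDef_smul_sincMatrix (N : ℕ) {R lam d : ℝ} (hR : 0 < R) (hlam : 0 < lam) (hd : 0 < d) :
    (R • sincMatrix N (phaseStep lam d)).PosDef :=
  (posDef_sincMatrix N (phaseStep_pos hlam hd).ne').smul hR

theorem isUnit_loadedImpedance (N : ℕ) {R lam d : ℝ} (hR : 0 < R) (hlam : 0 < lam) (hd : 0 < d)
    {X : Matrix (Fin N) (Fin N) ℝ} (hX : X.IsSymm) : IsUnit (loadedImpedance N R lam d X) := by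
  rw [loadedImpedance_eq N R hlam hd]
  exact isUnit_add_I_smul (posDef_smul_sincMatrix N hR hlam hd)
    ((isSymm_arrayReactance N R _).add hX)

theorem losChannel_eq (N : ℕ) (R lam γ d α : ℝ) :
    losChannel N R lam γ d α =
      ((√γ * R : ℝ) : ℂ) • planeWave N (phaseStep lam d) (Real.cos α) := rfl

theorem bestAmplitude_smul {n : Type*} [Fintype n] [DecidableEq n] {S : Matrix n n ℝ}
    (hS : S.PosDef) {R : ℝ} (hR : 0 < R) (p q : n → ℂ) :
    bestAmplitude ((R • S).map Complex.ofReal) p q =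
      R⁻¹ * bestAmplitude (S.map Complex.ofReal) p q := by
  have hinv : ((R • S).map Complex.ofReal)⁻¹ = ((R⁻¹ : ℝ) : ℂ) • (S.map Complex.ofReal)⁻¹ := by
    have h : (R • S).map Complex.ofReal = (R : ℂ) • S.map Complex.ofReal := by
      ext i j
      simp
    have hunit : IsUnit (S.map Complex.ofReal) := hS.isUnit.map Complex.ofRealHom.mapMatrix
    have hRc : (R : ℂ) ≠ 0 := by exact_mod_cast hR.ne'
    rw [h, Complex.ofReal_inv]
    exact inv_smul' _ (Units.mk0 (R : ℂ) hRc) ((isUnit_iff_isUnit_det _).1 hunit)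
  simp only [bestAmplitude, hinv, smul_mulVec, dotProduct_smul, smul_eq_mul, norm_mul,
    Complex.norm_real, Complex.re_ofReal_mul]
  rw [Real.norm_of_nonneg (by positivity), mul_mul_mul_comm, ← sq,
    Real.sqrt_mul (by positivity), Real.sqrt_sq (by positivity)]
  ring

/-- The supremum of the channel gains in closed form. -/
theorem isLUB_channelGains (N : ℕ) {R lam d : ℝ} (γDR γRS α : ℝ) (hR : 0 < R) (hlam : 0 < lam)
    (hd : 0 < d) :
    IsLUB (channelGains N R lam γDR γRS 0 α d) ((√γDR * √γRS * R *
      bestAmplitude ((sincMatrix N (phaseStep lam d)).map Complex.ofReal)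
        (planeWave N (phaseStep lam d) (Real.cos α)) (planeWave N (phaseStep lam d) 1)) ^ 2) := by
  set e := phaseStep lam d
  set p := planeWave N e (Real.cos α) with hp
  set q := planeWave N e 1 with hq
  set S := R • sincMatrix N e
  have hS : S.PosDef := posDef_smul_sincMatrix N hR hlam hd
  set c := √γDR * √γRS * R ^ 2 with hc
  have hc0 : 0 ≤ c := by positivity
  have hval : √γDR * √γRS * R * bestAmplitude ((sincMatrix N e).map Complex.ofReal) p q =
      c * bestAmplitude (S.map Complex.ofReal) p q := by
    have hC : (sincMatrix N e).PosDef := posDef_sincMatrix N (phaseStep_pos hlam hd).ne'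
    rw [bestAmplitude_smul hC hR, hc]
    field_simp
  have hgain : ∀ X : Matrix (Fin N) (Fin N) ℝ,
      ‖channel N R lam d 0 (losChannel N R lam γDR d α) (losChannel N R lam γRS d 0) X‖ =
        c * ‖p ⬝ᵥ (S.map Complex.ofReal
          + Complex.I • (arrayReactance N R e + X).map Complex.ofReal)⁻¹ *ᵥ q‖ := fun X => by
    rw [channel, zero_sub, norm_neg, loadedImpedance_eq N R hlam hd, losChannel_eq, losChannel_eq,
      Real.cos_zero, mulVec_smul, dotProduct_smul, smul_dotProduct, norm_smul, norm_smul,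
      Complex.norm_real, Complex.norm_real, Real.norm_of_nonneg (by positivity),
      Real.norm_of_nonneg (by positivity)]
    change √γRS * R * (√γDR * R * ‖p ⬝ᵥ _ *ᵥ q‖) = _
    rw [hc]
    ring
  rw [hval]
  refine isLUB_of_mem_closure ?_ ?_
  · rintro _ ⟨X, hX, rfl⟩
    rw [hgain]
    exact pow_le_pow_left₀ (by positivity) (mul_le_mul_of_nonneg_left
      (norm_dotProduct_add_I_smul_inv_le hS ((isSymm_arrayReactance N R e).add hX) p q) hc0) 2
  · obtain ⟨Y, hY, hlim⟩ := exists_tendsto_bestAmplitude hS p q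
    refine mem_closure_of_tendsto ((hlim.const_mul c).pow 2) (Eventually.of_forall fun k => ?_)
    refine ⟨Y k - arrayReactance N R e, (hY k).sub (isSymm_arrayReactance N R e), ?_⟩
    rw [hgain, add_sub_cancel]

theorem channelGain_eq (N : ℕ) {R lam d : ℝ} (γDR γRS α : ℝ) (hR : 0 < R) (hlam : 0 < lam)
    (hd : 0 < d) :
    channelGain N R lam γDR γRS 0 α d = (√γDR * √γRS * R *
      bestAmplitude ((sincMatrix N (phaseStep lam d)).map Complex.ofReal)
        (planeWave N (phaseStep lam d) (Real.cos α)) (planeWave N (phaseStep lam d) 1)) ^ 2 := by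
  -- The zero network shows that the supremum is not over the empty set.
  have hne : (channelGains N R lam γDR γRS 0 α d).Nonempty := ⟨_, 0, isSymm_zero, rfl⟩
  exact (isLUB_channelGains N γDR γRS α hR hlam hd).csSup_eq hne

theorem bestAmplitude_one_element (e x : ℝ) :
    bestAmplitude ((sincMatrix 1 e).map Complex.ofReal) (planeWave 1 e x) (planeWave 1 e 1) =
      1 := by
  have hC : (sincMatrix 1 e).map Complex.ofReal = 1 := by
    ext i j
    rw [Subsingleton.elim j i]
    simp [sincMatrix]
  have hw : ∀ y, planeWave 1 e y = 1 := fun y => by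
    ext i
    simp [planeWave]
  simp [bestAmplitude, hC, hw]

theorem arrayGain_eq (N : ℕ) {R lam γDR γRS d : ℝ} (α : ℝ) (hR : 0 < R) (hlam : 0 < lam)
    (hDR : 0 < γDR) (hRS : 0 < γRS) (hd : 0 < d) :
    arrayGain N R lam γDR γRS 0 α d =
      bestAmplitude ((sincMatrix N (phaseStep lam d)).map Complex.ofReal)
        (planeWave N (phaseStep lam d) (Real.cos α)) (planeWave N (phaseStep lam d) 1) ^ 2 := by
  have hc : √γDR * √γRS * R ≠ 0 := by positivity
  rw [arrayGain, channelGain_eq N γDR γRS α hR hlam hd, channelGain_eq 1 γDR γRS α hR hlam hd,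
    bestAmplitude_one_element, mul_one, mul_pow, mul_div_cancel_left₀ _ (pow_ne_zero 2 hc)]

theorem bestAmplitude_eq_arrayKernel (N : ℕ) {e : ℝ} (he : e ≠ 0) (x y : ℝ) :
    bestAmplitude ((sincMatrix N e).map Complex.ofReal) (planeWave N e x) (planeWave N e y) =
      (‖arrayKernel N e (-x) y‖ + √((arrayKernel N e x x).re * (arrayKernel N e y y).re)) / 2 := by
  have hx : planeWave N e x = star (planeWave N e (-x)) := by rw [star_planeWave, neg_neg]
  rw [bestAmplitude, star_planeWave_dotProduct_inv N he, star_planeWave_dotProduct_inv N he,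
    ← star_planeWave_dotProduct_inv N he (-x) y, ← hx]

/-- End-fire superdirectivity: the Legendre kernel at the endpoint `1` is `1 + 3 + … + (2N - 1)`. -/
theorem arrayKernel_zero_one_one (N : ℕ) : (arrayKernel N 0 1 1).re = (N : ℝ) ^ 2 := by
  rw [arrayKernel_zero, Complex.ofReal_re]
  simp_rw [legendre_eval_one, mul_one]
  induction N with
  | zero => simp
  | succ N ih =>
    rw [Finset.sum_range_succ, ih]
    push_cast
    ring

theorem half_le_arrayKernel_zero (N : ℕ) (x : ℝ) : (N : ℝ) / 2 ≤ (arrayKernel N 0 x x).re := by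
  rw [arrayKernel_zero, Complex.ofReal_re]
  simpa only [sq] using half_le_sum_legendre_sq N x

theorem tendsto_arrayGain (N : ℕ) {R lam γDR γRS : ℝ} (α : ℝ) (hR : 0 < R) (hlam : 0 < lam)
    (hDR : 0 < γDR) (hRS : 0 < γRS) :
    Tendsto (fun d => arrayGain N R lam γDR γRS 0 α d) (𝓝[>] 0)
      (𝓝 (((‖arrayKernel N 0 (-Real.cos α) 1‖
        + √((arrayKernel N 0 (Real.cos α) (Real.cos α)).re
          * (arrayKernel N 0 1 1).re)) / 2) ^ 2)) := by
  have hstep : Tendsto (phaseStep lam) (𝓝[>] 0) (𝓝 0) := by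
    have h : Continuous (phaseStep lam) := continuous_const.mul continuous_id
    have h0 := h.tendsto 0
    rw [show phaseStep lam 0 = 0 from mul_zero _] at h0
    exact h0.mono_left nhdsWithin_le_nhds
  have hK : ∀ x y, Tendsto (fun d => arrayKernel N (phaseStep lam d) x y) (𝓝[>] 0)
      (𝓝 (arrayKernel N 0 x y)) := fun x y => (continuousAt_arrayKernel N x y).tendsto.comp hstep
  have hre : ∀ x, Tendsto (fun d => (arrayKernel N (phaseStep lam d) x x).re) (𝓝[>] 0)
      (𝓝 (arrayKernel N 0 x x).re) := fun x => (Complex.continuous_re.tendsto _).comp (hK x x)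
  refine ((((hK _ _).norm.add ((hre _).mul (hre _)).sqrt).div_const 2).pow 2).congr' ?_
  filter_upwards [self_mem_nhdsWithin] with d hd
  rw [arrayGain_eq N α hR hlam hDR hRS hd,
    bestAmplitude_eq_arrayKernel N (phaseStep_pos hlam hd).ne']

end RIS

theorem theorem2 (N : ℕ) (R lam γDR γRS : ℝ) (hR : 0 < R) (hlam : 0 < lam)
    (hDR : 0 < γDR) (hRS : 0 < γRS) (αRx : ℝ) :
    (∀ d : ℝ, 0 < d →
      (∀ X : Matrix (Fin N) (Fin N) ℝ, X.IsSymm → IsUnit (RIS.loadedImpedance N R lam d X)) ∧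
      BddAbove (RIS.channelGains N R lam γDR γRS 0 αRx d)) ∧
    ∃ L : ℝ,
      Filter.Tendsto (fun d : ℝ => RIS.arrayGain N R lam γDR γRS 0 αRx d)
        (nhdsWithin 0 (Set.Ioi 0)) (nhds L) ∧
      (N : ℝ) ^ 3 / 8 ≤ L := by
  refine ⟨fun d hd => ⟨fun X hX => RIS.isUnit_loadedImpedance N hR hlam hd hX,
    (RIS.isLUB_channelGains N γDR γRS αRx hR hlam hd).bddAbove⟩, _,
    RIS.tendsto_arrayGain N αRx hR hlam hDR hRS, ?_⟩
  have h1 := RIS.arrayKernel_zero_one_one N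
  have h2 := RIS.half_le_arrayKernel_zero N (Real.cos αRx)
  rw [h1]
  set K := (RIS.arrayKernel N 0 (Real.cos αRx) (Real.cos αRx)).re
  have hK : 0 ≤ K := le_trans (by positivity) h2
  set A := ‖RIS.arrayKernel N 0 (-Real.cos αRx) 1‖
  have hA : 0 ≤ A := norm_nonneg _
  have hs : √(K * (N : ℝ) ^ 2) ^ 2 = K * (N : ℝ) ^ 2 := Real.sq_sqrt (by positivity)
  calc (N : ℝ) ^ 3 / 8 = (N : ℝ) / 2 * (N : ℝ) ^ 2 / 4 := by ring
    _ ≤ K * (N : ℝ) ^ 2 / 4 := by gcongr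
    _ = (√(K * (N : ℝ) ^ 2) / 2) ^ 2 := by rw [div_pow, hs]; norm_num
    _ ≤ ((A + √(K * (N : ℝ) ^ 2)) / 2) ^ 2 := by
      gcongr
      linarith
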